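/- Let $v\ge 1$ and $0\le e\le\binom v2$ be integers. Let $\mathcal G(v,e)$ be the set of simple graphs with $v$ vertices and $e$ edges, and for a graph $G$ let $P_2(G)$ be the sum of the squares of its vertex degrees. A graph $G\in\mathcal G(v,e)$ is optimal if $P_2(G)$ is maximum over $\mathcal G(v,e)$. Let $$\mathrm{Dis}(v,e)=\{(a_0,a_1,\dots,a_p): v>a_0>a_1>\dots>a_p>0,\ \textstyle\sum_s a_s=e\}$$ (including the empty partition if $e=0$). For $\pi=(a_0,\dots,a_p)\in\mathrm{Dis}(v,e)$ let $\mathrm{Th}(\pi)\in\mathcal G(v,e)$ be the threshold graph on $\{0,\dots,v-1\}$ in which, for $s<t$, the vertices $s$ and $t$ are adjacent if and only if $t\le s+a_s$ (with $a_s=0$ for $s>p$). The partition $\pi$ is optimal if $\mathrm{Th}(\pi)$ is optimal in $\mathcal G(v,e)$. Let $k,j$ be the unique integers with $e=\binom{k+1}2-j$, $1\le j\le k$, and let $k',j'$ be the unique integers with $e=\binom v2-\binom{k'+1}2+j'$, $1\le j'\le k'$. The quasi-complete graph $\mathrm{QC}(v,e)\in\mathcal G(v,e)$ consists of a complete graph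 on $k$ vertices, one further vertex joined to exactly $k-j$ of them, and isolated vertices (for $e=\binom v2$ it is the complete graph). The quasi-star graph $\mathrm{QS}(v,e)$ is the complement of $\mathrm{QC}(v,\binom v2-e)$. Put $C(v,e)=P_2(\mathrm{QC}(v,e))$ and $S(v,e)=P_2(\mathrm{QS}(v,e))$. Define the following partitions, where a hat marks an omitted part: - $\pi_{1.1}=(v-1,v-2,\dots,k'+1,j')$, the quasi-star partition (empty if $k'=v$); - $\pi_{1.2}=(v-1,v-2,\dots,\widehat{2k'-j'-1},\dots,k'-1)$, which exists if $k'+1\le 2k'-j'-1\le v-1$; - $\pi_{1.3}=(v-1,v-2,\dots,k'+1,2,1)$, which exists if $j'=3$ and $v\ge4$; - $\pi_{2.1}=(k,k-1,\dots,\widehat{j},\dots,2,1)$, the quasi-complete partition; - $\pi_{2.2}=(2k-j-1,k-2,k-3,\dots,2,1)$, which exists if $k+1\le 2k-j-1\le v-1$; - $\pi_{2.3}=(k,k-1,\dots,3)$, which exists if $j=3$ and $v\ge4$. Then: 1. If $\pi_{1.2}$ and $\pi_{1.3}$ both exist and are optimal, then $(v,e)=(7,9)$ or $(v,e)=(9,18)$.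 2. If $\pi_{2.2}$ and $\pi_{2.3}$ both exist and are optimal, then $(v,e)=(7,12)$ or $(v,e)=(9,18)$. 3. There are exactly six optimal partitions in $\mathrm{Dis}(v,e)$ if and only if $(v,e)=(9,18)$. 4. There is no pair $(v,e)$ with exactly five optimal partitions in $\mathrm{Dis}(v,e)$. 5. If there are more than two optimal partitions in $\mathrm{Dis}(v,e)$, then $S(v,e)=C(v,e)$, and both $\pi_{2.1}$ and $\pi_{1.1}$ are optimal. -/

import Mathlib

namespace SumSquares

/-- The class `𝒢(v,e)` of simple graphs on the `v` vertices `0, …, v-1` with exactly `e` edges. -/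
def graphClass (v e : ℕ) : Set (SimpleGraph (Fin v)) :=
  {G | G.edgeSet.ncard = e}

open Classical in
/-- `P₂(G)`, the sum of the squares of the vertex degrees of `G`. -/
noncomputable def P2 {v : ℕ} (G : SimpleGraph (Fin v)) : ℕ :=
  ∑ x : Fin v, G.degree x ^ 2

/-- `G` is optimal in `𝒢(v,e)`: it belongs to the class and `P₂(G)` is maximum there. -/
def IsOptimalGraph (v e : ℕ) (G : SimpleGraph (Fin v)) : Prop :=
  G ∈ graphClass v e ∧ ∀ H ∈ graphClass v e, P2 H ≤ P2 G

/-- `Dis(v,e)`: the strictly decreasing sequences `v > a₀ > a₁ > ⋯ > a_p > 0` with sum `e`. -/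
def Dis (v e : ℕ) : Set (List ℕ) :=
  {π | π.Pairwise (· > ·) ∧ (∀ a ∈ π, 0 < a ∧ a < v) ∧ π.sum = e}

/-- The threshold graph `Th(π)` of `π = (a₀, a₁, …)`: in row `s` of the upper triangular part of
its adjacency matrix the ones are exactly the first `a_s` entries, in columns `s+1, …, s+a_s`
(rows and columns are numbered from `0`, and `a_s = 0` beyond the last part). -/
def Th (v : ℕ) (π : List ℕ) : SimpleGraph (Fin v) :=
  SimpleGraph.fromRel fun s t => s.val < t.val ∧ t.val ≤ s.val + π.getD s.val 0

/-- `π` is an optimal partition in `Dis(v,e)`. -/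
def IsOptimal (v e : ℕ) (π : List ℕ) : Prop :=
  π ∈ Dis v e ∧ IsOptimalGraph v e (Th v π)

/-- The `k` of the representation `e = (k+1).choose 2 - j`, `1 ≤ j ≤ k`
(the largest `k` with `k.choose 2 ≤ e`; see `eq_choose_sub_iff`). -/
def kOf (e : ℕ) : ℕ := Nat.findGreatest (fun k => k.choose 2 ≤ e) (e + 1)

/-- The `j` of the representation `e = (k+1).choose 2 - j`, `1 ≤ j ≤ k`. -/
def jOf (e : ℕ) : ℕ := (kOf e + 1).choose 2 - e

/-- `kOf e` and `jOf e` are the unique `k`, `j` with `e = (k+1).choose 2 - j` and `1 ≤ j ≤ k`. -/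
theorem eq_choose_sub_iff (e k j : ℕ) :
    (e + j = (k + 1).choose 2 ∧ 1 ≤ j ∧ j ≤ k) ↔ (k = kOf e ∧ j = jOf e) := by
  have succ : ∀ n : ℕ, (n + 1).choose 2 = n + n.choose 2 := fun n => by
    rw [Nat.choose_succ_succ' n 1, Nat.choose_one_right]
  have bound : ∀ n : ℕ, n ≤ (n + 1).choose 2 := fun n => by rw [succ]; omega
  have h1 : (kOf e).choose 2 ≤ e :=
    Nat.findGreatest_spec (P := fun k => k.choose 2 ≤ e) (Nat.zero_le _) (by simp)
  have h2 : e < (kOf e + 1).choose 2 := by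
    by_contra hcon
    have h : kOf e + 1 ≤ e + 1 := by
      have := bound (kOf e)
      omega
    have := Nat.le_findGreatest (P := fun k => k.choose 2 ≤ e) h (not_lt.mp hcon)
    unfold kOf at this
    omega
  have hj : jOf e = (kOf e + 1).choose 2 - e := rfl
  have h3 := succ (kOf e)
  constructor
  · rintro ⟨ha, hb, hc⟩
    have hk := succ k
    have : k = kOf e := by
      rcases lt_trichotomy k (kOf e) with h | h | h
      · have := Nat.choose_le_choose 2 (show k + 1 ≤ kOf e from h)
        omega
      · exact h
      · have := Nat.choose_le_choose 2 (show kOf e + 1 ≤ k from h)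
        omega
    subst this
    omega
  · rintro ⟨rfl, rfl⟩
    omega

/-- `e' = v.choose 2 - e`, the number of edges of the complement of a graph in `𝒢(v,e)`. -/
def coEdges (v e : ℕ) : ℕ := v.choose 2 - e

/-- `k'` in the representation `e = v.choose 2 - (k'+1).choose 2 + j'`, `1 ≤ j' ≤ k'`, that is,
`e' = (k'+1).choose 2 - j'`. -/
def kOf' (v e : ℕ) : ℕ := kOf (coEdges v e)

/-- `j'` in the representation `e = v.choose 2 - (k'+1).choose 2 + j'`, `1 ≤ j' ≤ k'`. -/
def jOf' (v e : ℕ) : ℕ := jOf (coEdges v e)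

/-- The quasi-complete graph `QC(v,e)`: the complete graph on the vertices `0, …, k-1`, together
with the edges joining the vertex `k` to the vertices `0, …, k-j-1`. -/
def QC (v e : ℕ) : SimpleGraph (Fin v) :=
  SimpleGraph.fromRel fun s t =>
    (s.val < kOf e ∧ t.val < kOf e) ∨ (s.val < kOf e - jOf e ∧ t.val = kOf e)

/-- The quasi-star graph `QS(v,e)`: the complement of `QC(v,e')`. -/
def QS (v e : ℕ) : SimpleGraph (Fin v) := (QC v (coEdges v e))ᶜ

/-- `C(v,e)`, the sum of the squares of the degrees of the quasi-complete graph. -/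
noncomputable def C (v e : ℕ) : ℕ := P2 (QC v e)

/-- `S(v,e)`, the sum of the squares of the degrees of the quasi-star graph. -/
noncomputable def S (v e : ℕ) : ℕ := P2 (QS v e)

/-- The decreasing sequence `(a, a-1, …, b)`, empty if `a < b`. -/
def desc (a b : ℕ) : List ℕ := (List.range' b (a + 1 - b)).reverse

/-- The quasi-star partition `π₁.₁ = (v-1, v-2, …, k'+1, j')`, which is empty if `k' = v`
(that is, `e = 0`). -/
def pi11 (v e : ℕ) : List ℕ :=
  if kOf' v e = v then [] else desc (v - 1) (kOf' v e + 1) ++ [jOf' v e]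

/-- The condition `k'+1 ≤ 2k'-j'-1 ≤ v-1` under which `π₁.₂` exists. -/
def Exists12 (v e : ℕ) : Prop :=
  kOf' v e + 1 ≤ 2 * kOf' v e - jOf' v e - 1 ∧ 2 * kOf' v e - jOf' v e - 1 ≤ v - 1

/-- `π₁.₂ = (v-1, v-2, …, k'-1)` with the part `2k'-j'-1` left out. -/
def pi12 (v e : ℕ) : List ℕ :=
  (desc (v - 1) (kOf' v e - 1)).erase (2 * kOf' v e - jOf' v e - 1)

/-- The condition `j' = 3`, `v ≥ 4` under which `π₁.₃` exists. -/
def Exists13 (v e : ℕ) : Prop := jOf' v e = 3 ∧ 4 ≤ v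

/-- `π₁.₃ = (v-1, v-2, …, k'+1, 2, 1)`. -/
def pi13 (v e : ℕ) : List ℕ := desc (v - 1) (kOf' v e + 1) ++ [2, 1]

/-- The quasi-complete partition `π₂.₁ = (k, k-1, …, 2, 1)` with the part `j` left out. -/
def pi21 (e : ℕ) : List ℕ := (desc (kOf e) 1).erase (jOf e)

/-- The condition `k+1 ≤ 2k-j-1 ≤ v-1` under which `π₂.₂` exists. -/
def Exists22 (v e : ℕ) : Prop :=
  kOf e + 1 ≤ 2 * kOf e - jOf e - 1 ∧ 2 * kOf e - jOf e - 1 ≤ v - 1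

/-- `π₂.₂ = (2k-j-1, k-2, k-3, …, 2, 1)`. -/
def pi22 (e : ℕ) : List ℕ := (2 * kOf e - jOf e - 1) :: desc (kOf e - 2) 1

/-- The condition `j = 3`, `v ≥ 4` under which `π₂.₃` exists. -/
def Exists23 (v e : ℕ) : Prop := jOf e = 3 ∧ 4 ≤ v

/-- `π₂.₃ = (k, k-1, …, 3)`. -/
def pi23 (e : ℕ) : List ℕ := desc (kOf e) 3

/-- The set of all optimal partitions in `Dis(v,e)`. -/
def optimalPartitions (v e : ℕ) : Set (List ℕ) := {π | IsOptimal v e π}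

end SumSquares

/-!
The sum of the squared degrees of `Th(π)` depends only on the set `A ⊆ {1, …, n}`, `n = v-1`, of parts
of `π`: up to the number of edges it is the `weight`, the sum of `2 min(a,b)` over ordered pairs of
parts plus the sum of `a²`. A graph of maximum sum of squared degrees has an isolated vertex or a
vertex adjacent to all others (`exists_isolated_or_dominating`), so by induction the maximum over
graphs is the maximum over strict partitions, and `π` is optimal if and only if `A` has maximum weight
among the subsets of `{1, …, n}` with its sum (`isOptimal_iff`). Complementation of graphs becomes
complementation of `A` in `{1, …, n}` and changes the weight by a constant (`weight_compl`); it
exchanges `π₁.ᵢ` and `π₂.ᵢ`.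

The classification `IsMax.quasiComplete` of the sets of maximum weight goes by induction on `n`. Up to
complementation the part `n+1` is unused, so `A` also has maximum weight in `{1, …, n}`, and either `A`
or its complement there is one of the three quasi-complete sets. In the second case `A` is, up to sets
of equal weight, a quasi-star `{j} ∪ {k+1, …, n}`, and the exchanges in `IsMax.star_eq` and
`IsMax.complete_le` show that it is not of maximum weight in `{1, …, n+1}`, except when it is in the
list already.

The weights of `π₂.₂` and `π₂.₃` are equal to that of `π₂.₁` whenever they exist, and dually. If both
exist and are optimal then `j = 3` and a set of larger weight is available unless `k = 5, n = 6` or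
`k = 6, n = 8` (`IsMax.small_of_set21_three`). Hence five or more optimal partitions, or three of them
without both `π₁.₁` and `π₂.₁`, force one of `(7,9)`, `(7,12)`, `(9,18)`, where the values are compared
directly.
-/

namespace SumSquares

/-! ### The weight of a finite set of parts -/

/-- Twice the sum of `min a b` over ordered pairs of parts plus the sum of the squares of the parts.
For the set of parts of a strict partition `π` this is `P₂(Th(π))` plus the number of edges.
It takes rational values so that closed forms can be written with division. -/
def weight (A : Finset ℕ) : ℚ :=
  2 * ∑ a ∈ A, ∑ b ∈ A, (min a b : ℚ) + ∑ a ∈ A, (a : ℚ) ^ 2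

/-- The number of elements, the sum and the weight of `A` are `c`, `s` and `w`. -/
structure HasStats (A : Finset ℕ) (c s w : ℚ) : Prop where
  card_eq : (A.card : ℚ) = c
  sum_eq : ∑ a ∈ A, (a : ℚ) = s
  weight_eq : weight A = w

theorem hasStats_self (A : Finset ℕ) : HasStats A A.card (∑ a ∈ A, (a : ℚ)) (weight A) :=
  ⟨rfl, rfl, rfl⟩

theorem hasStats_empty : HasStats ∅ 0 0 0 := ⟨by simp, by simp, by simp [weight]⟩

theorem hasStats_singleton (c : ℕ) : HasStats {c} 1 c (2 * c + (c : ℚ) ^ 2) :=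
  ⟨by simp, by simp, by simp [weight]⟩

theorem HasStats.union {L H : Finset ℕ} {c₁ c₂ s₁ s₂ w₁ w₂ : ℚ} (hL : HasStats L c₁ s₁ w₁)
    (hH : HasStats H c₂ s₂ w₂) (h : ∀ a ∈ L, ∀ b ∈ H, a < b) :
    HasStats (L ∪ H) (c₁ + c₂) (s₁ + s₂) (w₁ + w₂ + 4 * c₂ * s₁) := by
  obtain ⟨rfl, rfl, rfl⟩ := hL
  obtain ⟨rfl, rfl, rfl⟩ := hH
  have hd : Disjoint L H := Finset.disjoint_left.2 fun a ha hb => lt_irrefl _ (h a ha a hb)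
  refine ⟨by rw [Finset.card_union_of_disjoint hd]; push_cast; rfl, Finset.sum_union hd, ?_⟩
  have h1 : ∑ a ∈ L, ∑ b ∈ H, (min a b : ℚ) = H.card * ∑ a ∈ L, (a : ℚ) := by
    rw [Finset.mul_sum]
    refine Finset.sum_congr rfl fun a ha => ?_
    rw [Finset.sum_congr rfl fun b hb => min_eq_left (by exact_mod_cast (h a ha b hb).le)]
    simp
  have h2 : ∑ a ∈ H, ∑ b ∈ L, (min a b : ℚ) = H.card * ∑ a ∈ L, (a : ℚ) := by
    rw [Finset.sum_comm, ← h1]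
    exact Finset.sum_congr rfl fun a _ => Finset.sum_congr rfl fun b _ => min_comm _ _
  simp only [weight, Finset.sum_union hd, Finset.sum_add_distrib, h1, h2]
  ring

theorem hasStats_Ioc {a b : ℕ} (h : a ≤ b) :
    HasStats (Finset.Ioc a b) (b - a) ((b * (b + 1) - a * (a + 1)) / 2)
      ((b * (b + 1) * (2 * b + 1) - a * (a + 1) * (2 * a + 1)) / 2
        - 2 * a * (a + 1) * (b - a)) := by
  induction b, h using Nat.le_induction with
  | base => simpa using hasStats_empty
  | succ b h ih =>
    have := ih.union (hasStats_singleton (b + 1)) (by simp)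
    rw [Finset.union_comm, ← Finset.insert_eq, Finset.insert_Ioc_right_eq_Ioc_add_one h] at this
    convert this using 1 <;> push_cast <;> ring

/-- Complementation in `{1, …, n}` changes the weight by an amount that depends only on `n` and on
the sum of the parts. -/
theorem weight_compl {n : ℕ} {A : Finset ℕ} (hA : A ⊆ Finset.Ioc 0 n) :
    weight A - weight (Finset.Ioc 0 n \ A) =
      (2 * n + 1) * (∑ a ∈ A, (a : ℚ) - ∑ a ∈ Finset.Ioc 0 n \ A, (a : ℚ)) := by
  have row : ∀ n a : ℕ, a ≤ n →
      ∑ b ∈ Finset.Ioc 0 n, (min a b : ℚ) = a * (a + 1) / 2 + a * (n - a) := by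
    intro n a ha
    induction n, ha using Nat.le_induction with
    | base =>
      rw [Finset.sum_congr rfl fun b hb => min_eq_right
        (by exact_mod_cast (Finset.mem_Ioc.1 hb).2), (hasStats_Ioc (Nat.zero_le a)).sum_eq]
      push_cast; ring
    | succ m h ih =>
      rw [← Finset.insert_Ioc_right_eq_Ioc_add_one (Nat.zero_le m), Finset.sum_insert (by simp),
        ih, min_eq_left (by exact_mod_cast h.trans (Nat.le_succ m))]
      push_cast; ring
  set D := Finset.Ioc 0 n \ A with hD
  have split : ∀ f : ℕ → ℚ, ∑ b ∈ Finset.Ioc 0 n, f b = ∑ b ∈ D, f b + ∑ b ∈ A, f b :=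
    fun f => (Finset.sum_sdiff hA).symm
  have key : ∀ X ⊆ Finset.Ioc 0 n, ∑ a ∈ X, (∑ b ∈ D, (min a b : ℚ) + ∑ b ∈ A, (min a b : ℚ)) =
      (2 * n + 1) / 2 * ∑ a ∈ X, (a : ℚ) - (∑ a ∈ X, (a : ℚ) ^ 2) / 2 := by
    intro X hX
    rw [Finset.mul_sum, Finset.sum_div, ← Finset.sum_sub_distrib]
    refine Finset.sum_congr rfl fun a ha => ?_
    rw [← split, row n a (Finset.mem_Ioc.1 (hX ha)).2]
    ring
  have hcomm : ∑ a ∈ A, ∑ b ∈ D, (min a b : ℚ) = ∑ a ∈ D, ∑ b ∈ A, (min a b : ℚ) := by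
    rw [Finset.sum_comm]
    exact Finset.sum_congr rfl fun a _ => Finset.sum_congr rfl fun b _ => min_comm _ _
  have kA := key A hA
  have kD := key D Finset.sdiff_subset
  rw [Finset.sum_add_distrib] at kA kD
  unfold weight
  linear_combination 2 * kA - 2 * kD - 2 * hcomm

/-! ### Sets of maximum weight -/

/-- `A ⊆ {1, …, n}` has maximum weight among the subsets of `{1, …, n}` with the same sum. -/
def IsMax (n : ℕ) (A : Finset ℕ) : Prop :=
  A ⊆ Finset.Ioc 0 n ∧
    ∀ B ⊆ Finset.Ioc 0 n, ∑ b ∈ B, (b : ℚ) = ∑ a ∈ A, (a : ℚ) → weight B ≤ weight A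

theorem IsMax.mono {m n : ℕ} {A : Finset ℕ} (h : IsMax n A) (hmn : m ≤ n)
    (hA : A ⊆ Finset.Ioc 0 m) : IsMax m A :=
  ⟨hA, fun B hB => h.2 B (hB.trans (Finset.Ioc_subset_Ioc_right hmn))⟩

theorem IsMax.compl {n : ℕ} {A : Finset ℕ} (h : IsMax n A) : IsMax n (Finset.Ioc 0 n \ A) := by
  refine ⟨Finset.sdiff_subset, fun B hB hs => ?_⟩
  have hB' := h.2 (Finset.Ioc 0 n \ B) Finset.sdiff_subset
  have sA : ∑ x ∈ Finset.Ioc 0 n \ A, (x : ℚ) + ∑ x ∈ A, (x : ℚ) = _ := Finset.sum_sdiff h.1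
  have sB : ∑ x ∈ Finset.Ioc 0 n \ B, (x : ℚ) + ∑ x ∈ B, (x : ℚ) = _ := Finset.sum_sdiff hB
  have hs' : ∑ x ∈ Finset.Ioc 0 n \ B, (x : ℚ) = ∑ x ∈ A, (x : ℚ) := by linarith
  have h1 := hB' hs'
  have h2 := weight_compl h.1
  have h3 := weight_compl hB
  rw [hs', hs] at h3
  linarith

theorem IsMax.of_weight_eq {n : ℕ} {A B : Finset ℕ} (h : IsMax n A) (hB : B ⊆ Finset.Ioc 0 n)
    (hs : ∑ b ∈ B, (b : ℚ) = ∑ a ∈ A, (a : ℚ)) (hw : weight B = weight A) : IsMax n B :=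
  ⟨hB, fun D hD hDs => hw ▸ h.2 D hD (hDs.trans hs)⟩

theorem IsMax.weight_le {n : ℕ} {A B : Finset ℕ} {c s w c' s' w' : ℚ} (h : IsMax n A)
    (hB : B ⊆ Finset.Ioc 0 n) (sA : HasStats A c s w) (sB : HasStats B c' s' w')
    (hs : s' = s) : w' ≤ w := by
  have := h.2 B hB (by rw [sA.sum_eq, sB.sum_eq, hs])
  rwa [sA.weight_eq, sB.weight_eq] at this

/-! ### Exchanges between quasi-stars and quasi-complete sets -/

/-- If `{j} ∪ {k+1, …, N}` with `j < k < N` has maximum weight in `{1, …, N+1}`, then `j` and `k` are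
both at most `N-k`, the number of large parts: otherwise cells of the short row can be moved to the
ends of the full rows with a gain. -/
theorem IsMax.star_bounds {j k N : ℕ} (hj : 0 < j) (hjk : j < k) (hkN : k < N)
    (h : IsMax (N + 1) ({j} ∪ Finset.Ioc k N)) : j + k ≤ N ∧ 2 * k ≤ N := by
  have hjp : j + k ≤ N := by
    by_contra hcon
    obtain ⟨p, rfl⟩ := Nat.exists_eq_add_of_lt hkN
    obtain ⟨d, rfl⟩ : ∃ d, j = p + 1 + (d + 1) := ⟨j - p - 2, by omega⟩
    obtain ⟨t, rfl⟩ := Nat.exists_eq_add_of_lt hjk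
    -- move one cell of the short row to the end of each full row
    have := h.weight_le (B := {d + 1} ∪ Finset.Ioc (p + 1 + (d + 1) + t + 1 + 1)
        (p + 1 + (d + 1) + t + 1 + p + 1 + 1))
      (by intro x; simp; omega)
      ((hasStats_singleton _).union (hasStats_Ioc (by omega)) (by simp; omega))
      ((hasStats_singleton _).union (hasStats_Ioc (by omega)) (by simp; omega))
      (by push_cast; ring)
    push_cast at this
    nlinarith [(Nat.cast_nonneg p : (0 : ℚ) ≤ p), (Nat.cast_nonneg t : (0 : ℚ) ≤ t),
      (mul_nonneg (Nat.cast_nonneg p) (Nat.cast_nonneg t) : (0 : ℚ) ≤ p * t)]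
  refine ⟨hjp, ?_⟩
  by_contra hcon
  obtain ⟨q, rfl⟩ : ∃ q, N = k + j + q := ⟨N - k - j, by omega⟩
  obtain ⟨t, rfl⟩ : ∃ t, k = j + q + t + 1 := ⟨k - j - q - 1, by omega⟩
  -- move the whole short row to the ends of the first `j` full rows
  have := h.weight_le (B := Finset.Ioc (j + q + t + 1) (j + q + t + 1 + q) ∪
      Finset.Ioc (j + q + t + 1 + q + 1) (j + q + t + 1 + q + j + 1))
    (by intro x; simp; omega)
    ((hasStats_singleton _).union (hasStats_Ioc (by omega)) (by simp; omega))
    ((hasStats_Ioc (by omega)).union (hasStats_Ioc (by omega)) (by simp; omega))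
    (by push_cast; ring)
  push_cast at this
  have hj' : (1 : ℚ) ≤ j := by exact_mod_cast hj
  nlinarith [(Nat.cast_nonneg t : (0 : ℚ) ≤ t),
    mul_nonneg (sub_nonneg.2 hj') (Nat.cast_nonneg t : (0 : ℚ) ≤ t)]

/-- A quasi-complete set with a hole strictly inside is not of maximum weight when there is much
room: the last columns can be moved to the first row. -/
theorem IsMax.hole_eq_one {j k N : ℕ} (hj : 0 < j) (hjk : j < k) (hkN : 2 * k ≤ N)
    (h : IsMax N (Finset.Ioc 0 (j - 1) ∪ Finset.Ioc j k)) : j = 1 ∧ k = 2 := by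
  rcases Nat.lt_or_ge 1 j with h1 | h1
  · exfalso
    obtain ⟨i, rfl⟩ : ∃ i, j = i + 2 := ⟨j - 2, by omega⟩
    obtain ⟨t, rfl⟩ := Nat.exists_eq_add_of_lt hjk
    -- move the `k-j` edges of the extra vertex and `j-1` further edges to the first row
    have := h.weight_le (B := Finset.Ioc 0 i ∪ Finset.Ioc (i + 1) (i + t + 1) ∪ {2 * (i + t) + 4})
      (by intro x; simp; omega)
      ((hasStats_Ioc (by omega)).union (hasStats_Ioc (by omega)) (by simp; omega))
      (((hasStats_Ioc (by omega)).union (hasStats_Ioc (by omega)) (by simp; omega)).union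
        (hasStats_singleton _) (by simp; omega))
      (by rw [Nat.add_sub_assoc (by norm_num)]; push_cast; ring)
    rw [Nat.add_sub_assoc (by norm_num)] at this
    push_cast at this
    nlinarith [(Nat.cast_nonneg t : (0 : ℚ) ≤ t), (Nat.cast_nonneg i : (0 : ℚ) ≤ i)]
  · obtain rfl : j = 1 := by omega
    refine ⟨rfl, ?_⟩
    by_contra hk
    obtain ⟨t, rfl⟩ : ∃ t, k = t + 3 := ⟨k - 3, by omega⟩
    have := h.weight_le (B := Finset.Ioc 1 (t + 1) ∪ {2 * t + 5})
      (by intro x; simp; omega)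
      ((hasStats_Ioc (by omega)).union (hasStats_Ioc (by omega)) (by simp))
      ((hasStats_Ioc (by omega)).union (hasStats_singleton _) (by simp; omega))
      (by push_cast; ring)
    push_cast at this
    nlinarith [(Nat.cast_nonneg t : (0 : ℚ) ≤ t)]

/-- A complete set `{1, …, m}` with `m ≥ 3` is not of maximum weight when there is much room. -/
theorem IsMax.complete_le {m N : ℕ} (hN : 2 * m + 2 ≤ N) (h : IsMax N (Finset.Ioc 0 m)) :
    m ≤ 2 := by
  by_contra hm
  obtain ⟨t, rfl⟩ : ∃ t, m = t + 3 := ⟨m - 3, by omega⟩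
  have := h.weight_le (B := Finset.Ioc 1 (t + 1) ∪ {2 * t + 6})
    (by intro x; simp; omega)
    (hasStats_Ioc (by omega))
    ((hasStats_Ioc (by omega)).union (hasStats_singleton _) (by simp; omega))
    (by push_cast; ring)
  push_cast at this
  nlinarith [(Nat.cast_nonneg t : (0 : ℚ) ≤ t)]

theorem compl_star {j k N : ℕ} (hj : 0 < j) (hjk : j ≤ k) (hkN : k ≤ N) :
    Finset.Ioc 0 N \ ({j} ∪ Finset.Ioc k N) = Finset.Ioc 0 (j - 1) ∪ Finset.Ioc j k := by
  ext x; simp; omega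

/-- A quasi-star that leaves the largest part unused has maximum weight only in trivial cases. -/
theorem IsMax.star_eq {j k N : ℕ} (hj : 0 < j) (hjk : j < k) (hkN : k < N)
    (h : IsMax (N + 1) ({j} ∪ Finset.Ioc k N)) : j = 1 ∧ k = 2 := by
  have hN := (h.star_bounds hj hjk hkN).2
  have h' := (h.mono (Nat.le_succ N) (by intro x; simp; omega)).compl
  rw [compl_star hj hjk.le hkN.le] at h'
  exact h'.hole_eq_one hj hjk hN

/-! ### Classification of the sets of maximum weight -/

/-- The sets of parts of the three partitions `π₂.₁`, `π₂.₂`, `π₂.₃`, over all admissible `k`, `j`.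
In the second family the isolated part is `c = 2k-j-1` and `m = k-2`. -/
def QuasiComplete (A : Finset ℕ) : Prop :=
  (∃ j k, 0 < j ∧ j ≤ k ∧ A = Finset.Ioc 0 (j - 1) ∪ Finset.Ioc j k) ∨
  (∃ m c, m + 3 ≤ c ∧ c ≤ 2 * m + 2 ∧ A = Finset.Ioc 0 m ∪ {c}) ∨
  ∃ k, 3 ≤ k ∧ A = Finset.Ioc 2 k

/-- The inductive step for the sets of maximum weight in `{1, …, n+1}` that do not contain `n+1`
and are complements of quasi-complete sets in `{1, …, n}`. -/
theorem IsMax.quasiComplete_of_compl {n : ℕ} {A : Finset ℕ} (h : IsMax (n + 1) A)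
    (hA : A ⊆ Finset.Ioc 0 n) (hq : QuasiComplete (Finset.Ioc 0 n \ A)) :
    QuasiComplete A ∨ QuasiComplete (Finset.Ioc 0 (n + 1) \ A) := by
  have hmem : ∀ x, x ∈ A ↔ (0 < x ∧ x ≤ n) ∧ x ∉ Finset.Ioc 0 n \ A := by
    intro x
    have := @hA x
    simp only [Finset.mem_Ioc] at this
    simp only [Finset.mem_sdiff, Finset.mem_Ioc]
    tauto
  have hB : Finset.Ioc 0 n \ A ⊆ Finset.Ioc 0 n := Finset.sdiff_subset
  rcases hq with ⟨j, k, hj, hjk, hq⟩ | ⟨m, c, hmc, hcm, hq⟩ | ⟨k, hk, hq⟩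
  · rcases hjk.lt_or_eq with hjk' | rfl
    · have hkn : k ≤ n := by
        have : k ∈ Finset.Ioc 0 n := hB (hq ▸ by simp [hjk'])
        exact (Finset.mem_Ioc.1 this).2
      obtain rfl : A = {j} ∪ Finset.Ioc k n := by
        ext x; rw [hmem, hq]; simp; omega
      rcases hkn.lt_or_eq with hkn' | rfl
      · obtain ⟨rfl, rfl⟩ := h.star_eq hj hjk' hkn'
        exact .inl (.inl ⟨2, n, by omega, by omega, by simp⟩)
      · exact .inr (.inl ⟨j, k + 1, by omega, by omega, by ext x; simp; omega⟩)
    · obtain ⟨m, rfl⟩ : ∃ m, j = m + 1 := ⟨j - 1, by omega⟩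
      have hmn : m ≤ n := by
        rcases Nat.eq_zero_or_pos m with rfl | hm
        · omega
        · have : m ∈ Finset.Ioc 0 n := hB (hq ▸ by simp; omega)
          exact (Finset.mem_Ioc.1 this).2
      have hq' : Finset.Ioc 0 n \ A = Finset.Ioc 0 m := by rw [hq]; simp
      obtain rfl : A = Finset.Ioc m n := by
        ext x; rw [hmem, hq']; simp; omega
      rcases Nat.lt_or_ge (2 * m + 1) n with hn | hn
      · have h' := (h.mono (Nat.le_succ n) hA).compl
        rw [hq'] at h'
        have := h'.complete_le (by omega)
        interval_cases m
        · exact .inl (.inl ⟨n + 1, n + 1, by omega, by omega, by simp⟩)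
        · exact .inl (.inl ⟨1, n, by omega, by omega, by simp⟩)
        · exact .inl (.inr (.inr ⟨n, by omega, rfl⟩))
      · rcases Nat.lt_or_ge (m + 1) n with hn' | hn'
        · exact .inr (.inr (.inl ⟨m, n + 1, by omega, by omega, by ext x; simp; omega⟩))
        · rcases hmn.lt_or_eq with hn'' | rfl
          · exact .inr (.inl ⟨m + 1, m + 2, by omega, by omega, by ext x; simp; omega⟩)
          · exact .inl (.inl ⟨1, 1, by omega, by omega, by simp⟩)
  · exfalso
    have hcn : c ≤ n := by
      have : c ∈ Finset.Ioc 0 n := hB (hq ▸ by simp)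
      exact (Finset.mem_Ioc.1 this).2
    obtain rfl : A = Finset.Ioc m (c - 1) ∪ Finset.Ioc c n := by
      ext x; rw [hmem, hq]; simp; omega
    obtain ⟨i, rfl⟩ : ∃ i, c = m + 3 + i := ⟨c - m - 3, by omega⟩
    obtain ⟨l, rfl⟩ : ∃ l, m = i + 1 + l := ⟨m - i - 1, by omega⟩
    obtain ⟨p, rfl⟩ := Nat.exists_eq_add_of_le hcn
    have sA := (hasStats_Ioc (show i + 1 + l ≤ i + 1 + l + 3 + i - 1 by omega)).union
      (hasStats_Ioc hcn) (by simp; omega)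
    have sB := (hasStats_singleton (l + 1)).union (hasStats_Ioc
      (show i + 1 + l + 2 ≤ i + 1 + l + 3 + i + p by omega)) (by simp; omega)
    have e : i + 1 + l + 3 + i - 1 = i + 1 + l + 2 + i := by omega
    rw [e] at sA h
    have h' := h.of_weight_eq (B := {l + 1} ∪ Finset.Ioc (i + 1 + l + 2) (i + 1 + l + 3 + i + p))
      (by intro x; simp; omega)
      (by rw [sA.sum_eq, sB.sum_eq]; push_cast; ring)
      (by rw [sA.weight_eq, sB.weight_eq]; push_cast; ring)
    have := h'.star_eq (by omega) (by omega) (by omega)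
    omega
  · have hkn : k ≤ n := by
      have : k ∈ Finset.Ioc 0 n := hB (hq ▸ by simp; omega)
      exact (Finset.mem_Ioc.1 this).2
    obtain rfl : A = Finset.Ioc 0 2 ∪ Finset.Ioc k n := by
      ext x; rw [hmem, hq]; simp; omega
    rcases hkn.lt_or_eq with hkn' | rfl
    · rcases hk.lt_or_eq with hk' | rfl
      · have sA := (hasStats_Ioc (Nat.zero_le 2)).union (hasStats_Ioc hkn) (by simp; omega)
        have sB := (hasStats_singleton 3).union (hasStats_Ioc hkn) (by simp; omega)
        have h' := h.of_weight_eq (B := {3} ∪ Finset.Ioc k n) (by intro x; simp; omega)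
          (by rw [sA.sum_eq, sB.sum_eq]; push_cast; ring)
          (by rw [sA.weight_eq, sB.weight_eq]; push_cast; ring)
        have := h'.star_eq (by omega) (by omega) (by omega)
        omega
      · exact .inl (.inl ⟨3, n, by omega, by omega, rfl⟩)
    · exact .inl (.inl ⟨3, 3, by omega, by omega, by simp⟩)

/-- A set of maximum weight is quasi-complete, or its complement is. The induction discards the
part `n+1`, which after complementation may be assumed to be missing. -/
theorem IsMax.quasiComplete {n : ℕ} {A : Finset ℕ} (h : IsMax n A) :
    QuasiComplete A ∨ QuasiComplete (Finset.Ioc 0 n \ A) := by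
  induction n generalizing A with
  | zero =>
    have hA := h.1
    obtain rfl : A = ∅ := by simpa using hA
    exact .inl (.inl ⟨1, 1, by omega, by omega, by simp⟩)
  | succ n ih =>
    have step : ∀ D : Finset ℕ, IsMax (n + 1) D → n + 1 ∉ D →
        QuasiComplete D ∨ QuasiComplete (Finset.Ioc 0 (n + 1) \ D) := by
      intro D hD hn
      have hsub : D ⊆ Finset.Ioc 0 n := by
        intro x hx
        have h1 := Finset.mem_Ioc.1 (hD.1 hx)
        have h2 : x ≠ n + 1 := fun h => hn (h ▸ hx)
        exact Finset.mem_Ioc.2 (by omega)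
      rcases ih (hD.mono (Nat.le_succ n) hsub) with h1 | h1
      · exact .inl h1
      · exact hD.quasiComplete_of_compl hsub h1
    by_cases hn : n + 1 ∈ A
    · have := step _ h.compl (by simp [hn])
      rw [Finset.sdiff_sdiff_eq_self h.1] at this
      exact this.symm
    · exact step A h hn

/-- The set of parts of `π₂.₁`. -/
def set21 (k j : ℕ) : Finset ℕ := Finset.Ioc 0 (j - 1) ∪ Finset.Ioc j k

/-- The set of parts of `π₂.₂`. -/
def set22 (k j : ℕ) : Finset ℕ := Finset.Ioc 0 (k - 2) ∪ {2 * k - j - 1}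

/-- The set of parts of `π₂.₃`. -/
def set23 (k : ℕ) : Finset ℕ := Finset.Ioc 2 k

theorem hasStats_set21 {k j : ℕ} (hj : 0 < j) (hjk : j ≤ k) :
    HasStats (set21 k j) (k - 1) (k * (k + 1) / 2 - j)
      (k * (k + 1) * (2 * k + 1) / 2 - j ^ 2 - 2 * j - 4 * j * (k - j) - 2 * j * (j - 1)) := by
  obtain ⟨i, rfl⟩ : ∃ i, j = i + 1 := ⟨j - 1, by omega⟩
  have := (hasStats_Ioc (Nat.zero_le i)).union (hasStats_Ioc hjk) (by simp; omega)
  unfold set21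
  rw [Nat.add_sub_cancel]
  convert this using 1 <;> push_cast <;> ring

/-- Moving the `k-j` edges at the extra vertex of a quasi-complete graph to a vertex of the clique
does not change the weight. -/
theorem hasStats_set22 {k j : ℕ} (hj : 0 < j) (hk : k + 1 ≤ 2 * k - j - 1) :
    HasStats (set22 k j) (k - 1) (k * (k + 1) / 2 - j)
      (k * (k + 1) * (2 * k + 1) / 2 - j ^ 2 - 2 * j - 4 * j * (k - j) - 2 * j * (j - 1)) := by
  obtain ⟨t, rfl⟩ : ∃ t, k = j + t + 2 := ⟨k - j - 2, by omega⟩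
  have := (hasStats_Ioc (Nat.zero_le (j + t))).union (hasStats_singleton (j + 2 * t + 3))
    (by simp; omega)
  unfold set22
  rw [show j + t + 2 - 2 = j + t by omega,
    show 2 * (j + t + 2) - j - 1 = j + 2 * t + 3 by omega]
  convert this using 1 <;> push_cast <;> ring

/-- A triangle and a star with three edges have the same sum of squares of degrees; hence so do
their complements. -/
theorem hasStats_set23 {k : ℕ} (hk : 3 ≤ k) :
    HasStats (set23 k) (k - 2) (k * (k + 1) / 2 - 3)
      (k * (k + 1) * (2 * k + 1) / 2 - 3 ^ 2 - 2 * 3 - 4 * 3 * (k - 3) - 2 * 3 * (3 - 1)) := by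
  have := hasStats_Ioc (show 2 ≤ k by omega)
  unfold set23
  convert this using 1 <;> push_cast <;> ring

/-- A quasi-complete set with a given sum is one of three. -/
theorem QuasiComplete.eq_of_sum {n e : ℕ} {A : Finset ℕ} (h : QuasiComplete A)
    (hA : A ⊆ Finset.Ioc 0 n) (hs : ∑ a ∈ A, (a : ℚ) = e) :
    A = set21 (kOf e) (jOf e) ∨
    (kOf e + 1 ≤ 2 * kOf e - jOf e - 1 ∧ 2 * kOf e - jOf e - 1 ≤ n ∧
      A = set22 (kOf e) (jOf e)) ∨
    (jOf e = 3 ∧ 3 ≤ n ∧ A = set23 (kOf e)) := by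
  have key : ∀ k j : ℕ, 0 < j → j ≤ k → (e : ℚ) = k * (k + 1) / 2 - j →
      k = kOf e ∧ j = jOf e := by
    intro k j hj hjk he
    refine (eq_choose_sub_iff e k j).1 ⟨?_, hj, hjk⟩
    have : ((e + j : ℕ) : ℚ) = ((k + 1).choose 2 : ℕ) := by
      rw [Nat.cast_choose_two]; push_cast; rw [he]; ring
    exact_mod_cast this
  rcases h with ⟨j, k, hj, hjk, rfl⟩ | ⟨m, c, hmc, hcm, rfl⟩ | ⟨k, hk, rfl⟩
  · obtain ⟨rfl, rfl⟩ := key k j hj hjk (by rw [← hs]; exact (hasStats_set21 hj hjk).sum_eq)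
    exact .inl rfl
  · have hc : c ∈ Finset.Ioc 0 n := hA (by simp)
    have heq : set22 (m + 2) (2 * m + 3 - c) = Finset.Ioc 0 m ∪ {c} := by
      unfold set22
      rw [show m + 2 - 2 = m by omega, show 2 * (m + 2) - (2 * m + 3 - c) - 1 = c by omega]
    obtain ⟨h1, h2⟩ := key (m + 2) (2 * m + 3 - c) (by omega) (by omega)
      (by rw [← hs, ← heq]; exact (hasStats_set22 (by omega) (by omega)).sum_eq)
    rw [← h1, ← h2]
    have := Finset.mem_Ioc.1 hc
    exact .inr (.inl ⟨by omega, by omega, heq.symm⟩)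
  · obtain ⟨h1, h2⟩ := key k 3 (by omega) hk
      (by rw [← hs]; exact_mod_cast (hasStats_set23 hk).sum_eq)
    have hc := Finset.mem_Ioc.1 (hA (show k ∈ Finset.Ioc 2 k by simp; omega))
    rw [← h1, ← h2]
    exact .inr (.inr ⟨rfl, by omega, rfl⟩)

/-- If `{1, …, k}` without `3` has maximum weight and there is room for a part `2k-4 > k`, then
`k ≤ 6` and the room is no larger than necessary. -/
theorem IsMax.small_of_set21_three {n k : ℕ} (h : IsMax n (set21 k 3)) (hk : k + 1 ≤ 2 * k - 4)
    (hn : 2 * k - 4 ≤ n) : k = 5 ∧ n = 6 ∨ k = 6 ∧ n = 8 := by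
  have s := hasStats_set21 (show 0 < 3 by omega) (show 3 ≤ k by omega)
  rcases Nat.lt_or_ge k 7 with hk7 | hk7
  · obtain rfl | rfl : k = 5 ∨ k = 6 := by omega
    · refine .inl ⟨rfl, ?_⟩
      by_contra hne
      -- quasi-stars on more vertices than the least possible number
      have := h.weight_le (B := {5} ∪ {7}) (by
        intro x
        simp only [Finset.mem_Ioc, Finset.mem_singleton, Finset.mem_union]
        omega) s
        ((hasStats_singleton _).union (hasStats_singleton _) (by simp)) (by norm_num)
      norm_num at this
    · refine .inr ⟨rfl, ?_⟩
      by_contra hne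
      have := h.weight_le (B := {1} ∪ Finset.Ioc 7 9) (by intro x; simp; omega) s
        ((hasStats_singleton _).union (hasStats_Ioc (by omega)) (by simp; omega)) (by norm_num)
      norm_num at this
  · exfalso
    obtain ⟨t, rfl⟩ : ∃ t, k = t + 7 := ⟨k - 7, by omega⟩
    -- two full rows, a third one that is three short of them, and the rest of a clique
    have := h.weight_le (B := Finset.Ioc 1 (t + 1) ∪ {2 * t + 6} ∪ Finset.Ioc (2 * t + 8) (2 * t + 10))
      (by intro x; simp; omega) s
      (((hasStats_Ioc (by omega)).union (hasStats_singleton _) (by simp; omega)).union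
        (hasStats_Ioc (by omega)) (by
          intro a ha b hb
          simp only [Finset.mem_Ioc, Finset.mem_singleton, Finset.mem_union] at ha hb
          omega)) (by push_cast; ring)
    push_cast at this
    nlinarith [(Nat.cast_nonneg t : (0 : ℚ) ≤ t)]

/-! ### Sums of degrees and of squares of degrees -/

section Degrees

variable {V W : Type*} [Fintype V] [Fintype W]

open Classical in
/-- The degree of a vertex, as a rational number. -/
noncomputable def deg (G : SimpleGraph V) (x : V) : ℚ := ∑ y, if G.Adj x y then 1 else 0

/-- The sum of the degrees of a graph is `d` and the sum of their squares is `q`. -/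
structure HasDegrees (G : SimpleGraph V) (d q : ℚ) : Prop where
  sum_eq : ∑ x, deg G x = d
  sq_eq : ∑ x, deg G x ^ 2 = q

open Classical in
theorem degree_eq_deg (G : SimpleGraph V) (x : V) : (G.degree x : ℚ) = deg G x := by
  rw [deg, ← SimpleGraph.card_neighborFinset_eq_degree, SimpleGraph.neighborFinset_eq_filter]
  simp

theorem sum_deg (G : SimpleGraph V) : ∑ x, deg G x = 2 * G.edgeSet.ncard := by
  classical
  have := G.sum_degrees_eq_twice_card_edges
  rw [← Set.ncard_coe_finset, SimpleGraph.coe_edgeFinset] at this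
  simp_rw [← degree_eq_deg]
  rw [← Nat.cast_sum]
  norm_cast

theorem P2_eq_sum_deg {v : ℕ} (G : SimpleGraph (Fin v)) : (P2 G : ℚ) = ∑ x, deg G x ^ 2 := by
  simp [P2, degree_eq_deg]

theorem deg_compl (G : SimpleGraph V) (x : V) : deg Gᶜ x = Fintype.card V - 1 - deg G x := by
  classical
  have h : deg Gᶜ x + deg G x + 1 = Fintype.card V := by
    have : (1 : ℚ) = ∑ y : V, if x = y then 1 else 0 := by simp
    rw [this, deg, deg, ← Finset.sum_add_distrib, ← Finset.sum_add_distrib, Fintype.card,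
      Finset.card_eq_sum_ones, Nat.cast_sum]
    refine Finset.sum_congr rfl fun y _ => ?_
    by_cases hxy : x = y
    · subst hxy; simp
    · by_cases ha : G.Adj x y <;> simp [hxy, ha]
  linarith

theorem HasDegrees.compl {G : SimpleGraph V} {d q : ℚ} (h : HasDegrees G d q) :
    HasDegrees Gᶜ (Fintype.card V * (Fintype.card V - 1) - d)
      (Fintype.card V * (Fintype.card V - 1) ^ 2 - 2 * (Fintype.card V - 1) * d + q) := by
  constructor
  · simp_rw [deg_compl, ← h.sum_eq, Finset.sum_sub_distrib]
    simp; ring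
  · simp_rw [deg_compl, ← h.sum_eq, ← h.sq_eq, sub_sq _ (deg G _), Finset.sum_add_distrib,
      Finset.sum_sub_distrib, ← Finset.mul_sum]
    simp

/-- Adding an isolated vertex. -/
theorem HasDegrees.of_isolated {G : SimpleGraph V} (f : Option W ≃ V) {d q : ℚ}
    (h : HasDegrees (G.comap fun w => f (some w)) d q) (hf : ∀ w, ¬ G.Adj (f none) (f (some w))) :
    HasDegrees G d q := by
  have h0 : deg G (f none) = 0 := by
    rw [deg, ← f.sum_comp, Fintype.sum_option]
    simp [hf]
  have h1 : ∀ w, deg G (f (some w)) = deg (G.comap fun w => f (some w)) w := by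
    intro w
    rw [deg, ← f.sum_comp, Fintype.sum_option, if_neg fun h => hf w h.symm, zero_add]
    rfl
  constructor
  · rw [← f.sum_comp, Fintype.sum_option, h0]
    simp [h1, h.sum_eq]
  · rw [← f.sum_comp, Fintype.sum_option, h0]
    simp [h1, h.sq_eq]

/-- Adding a vertex that is adjacent to all others. -/
theorem HasDegrees.of_dominating {G : SimpleGraph V} (f : Option W ≃ V) {d q : ℚ}
    (h : HasDegrees (G.comap fun w => f (some w)) d q) (hf : ∀ w, G.Adj (f none) (f (some w))) :
    HasDegrees G (d + 2 * Fintype.card W)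
      (q + 2 * d + Fintype.card W + (Fintype.card W : ℚ) ^ 2) := by
  have h0 : deg G (f none) = Fintype.card W := by
    rw [deg, ← f.sum_comp, Fintype.sum_option]
    simp [hf]
  have h1 : ∀ w, deg G (f (some w)) = deg (G.comap fun w => f (some w)) w + 1 := by
    intro w
    rw [deg, ← f.sum_comp, Fintype.sum_option, if_pos (hf w).symm, add_comm]
    rfl
  constructor
  · rw [← f.sum_comp, Fintype.sum_option, h0]
    simp [h1, h.sum_eq, Finset.sum_add_distrib]; ring
  · rw [← f.sum_comp, Fintype.sum_option, h0]
    simp [h1, ← h.sum_eq, ← h.sq_eq, Finset.sum_add_distrib, add_sq, ← Finset.mul_sum]; ring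

/-! ### Extremal graphs have an isolated or a dominating vertex -/

/-- Replacing an edge `yz` by `xy`, where `z` has at most the degree of `x`, increases the sum of
the squares of the degrees. -/
theorem exists_sq_lt {G : SimpleGraph V} {x y z : V} (hxy : x ≠ y) (hxz : x ≠ z)
    (hG : ¬ G.Adj x y) (hyz : G.Adj y z) (hdeg : deg G z ≤ deg G x) :
    ∃ H : SimpleGraph V, ∑ a, deg H a = ∑ a, deg G a ∧ ∑ a, deg G a ^ 2 < ∑ a, deg H a ^ 2 := by
  classical
  let H : SimpleGraph V :=
    { Adj := fun a b => (G.Adj a b ∧ s(a, b) ≠ s(y, z)) ∨ s(a, b) = s(x, y)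
      symm := ⟨fun a b => by rw [G.adj_comm, Sym2.eq_swap]; exact id⟩
      loopless := ⟨fun a h => by
        rcases h with h | h
        · exact G.irrefl h.1
        · rw [Sym2.eq_iff] at h
          rcases h with h | h
          · exact hxy (h.1.symm.trans h.2)
          · exact hxy (h.2.symm.trans h.1)⟩ }
  have hadj : ∀ a b, H.Adj a b ↔ (G.Adj a b ∧ s(a, b) ≠ s(y, z)) ∨ s(a, b) = s(x, y) :=
    fun _ _ => Iff.rfl
  have hne := hyz.ne
  have count : ∀ p q : V, p ≠ q → ∀ a, ∑ b, (if s(a, b) = s(p, q) then (1 : ℚ) else 0) =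
      (if a = p then 1 else 0) + if a = q then 1 else 0 := by
    intro p q hpq a
    have : ∀ b, (if s(a, b) = s(p, q) then (1 : ℚ) else 0) =
        (if q = b then (if a = p then 1 else 0) else 0) +
        (if p = b then (if a = q then 1 else 0) else 0) := by
      intro b
      simp only [Sym2.eq_iff]
      grind
    simp_rw [this, Finset.sum_add_distrib]
    simp
  have hd : ∀ a, deg H a = deg G a + (if a = x then 1 else 0) - if a = z then 1 else 0 := by
    intro a
    have : deg H a = deg G a - ∑ b, (if s(a, b) = s(y, z) then (1 : ℚ) else 0) +
        ∑ b, (if s(a, b) = s(x, y) then (1 : ℚ) else 0) := by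
      rw [deg, deg, ← Finset.sum_sub_distrib, ← Finset.sum_add_distrib]
      refine Finset.sum_congr rfl fun b _ => ?_
      by_cases h1 : s(a, b) = s(x, y)
      · have h2 : ¬ G.Adj a b := by
          rwa [← SimpleGraph.mem_edgeSet, h1, SimpleGraph.mem_edgeSet]
        have h3 : s(a, b) ≠ s(y, z) := by
          intro h
          rw [← SimpleGraph.mem_edgeSet, h] at h2
          exact h2 hyz
        rw [if_pos ((hadj a b).2 (.inr h1)), if_neg h2, if_neg h3, if_pos h1]
        norm_num
      · by_cases h3 : s(a, b) = s(y, z)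
        · have h2 : G.Adj a b := by
            rwa [← SimpleGraph.mem_edgeSet, h3, SimpleGraph.mem_edgeSet]
          simp [hadj, h3, h2]
        · simp [hadj, h1, h3]
    rw [this, count y z hne, count x y hxy]
    ring
  refine ⟨H, by simp [hd, Finset.sum_add_distrib], ?_⟩
  have hsq : ∀ a, deg H a ^ 2 = deg G a ^ 2 + (if a = x then 2 * deg G a + 1 else 0) +
      (if a = z then -2 * deg G a + 1 else 0) := by
    intro a
    rw [hd]
    by_cases h1 : a = x
    · have h2 : a ≠ z := h1 ▸ hxz
      simp only [if_pos h1, if_neg h2]; ring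
    · by_cases h2 : a = z
      · simp only [if_neg h1, if_pos h2]; ring
      · simp only [if_neg h1, if_neg h2]; ring
  simp_rw [hsq, Finset.sum_add_distrib]
  simp
  linarith

theorem exists_isolated_or_dominating [Nonempty V] {G : SimpleGraph V}
    (hG : ∀ H : SimpleGraph V, ∑ a, deg H a = ∑ a, deg G a →
      ∑ a, deg H a ^ 2 ≤ ∑ a, deg G a ^ 2) :
    ∃ x, (∀ y, ¬ G.Adj x y) ∨ ∀ y, y ≠ x → G.Adj x y := by
  obtain ⟨x, hx⟩ := Finite.exists_max (deg G)
  by_cases h : ∀ y, y ≠ x → G.Adj x y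
  · exact ⟨x, .inr h⟩
  · push Not at h
    obtain ⟨y, hyx, hxy⟩ := h
    refine ⟨y, .inl fun z hz => ?_⟩
    have hxz : x ≠ z := by rintro rfl; exact hxy hz.symm
    obtain ⟨H, h1, h2⟩ := exists_sq_lt hyx.symm hxz hxy hz (hx z)
    exact absurd (hG H h1) (not_le.2 h2)

end Degrees

/-- The sum of the squares of the degrees of a graph on `n` vertices is bounded by the value of
some strict partition with parts less than `n`. -/
theorem exists_weight_ge (n : ℕ) : ∀ (V : Type) [Fintype V], Fintype.card V = n →
    ∀ G : SimpleGraph V, ∃ A ⊆ Finset.Ioc 0 (n - 1), ∑ x, deg G x = 2 * ∑ a ∈ A, (a : ℚ) ∧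
      ∑ x, deg G x ^ 2 ≤ weight A - ∑ a ∈ A, (a : ℚ) := by
  classical
  induction n with
  | zero =>
    intro V _ hV G
    have := Fintype.card_eq_zero_iff.1 hV
    exact ⟨∅, by simp, by simp, by simp [hasStats_empty.weight_eq]⟩
  | succ n ih =>
    intro V _ hV G₀
    obtain ⟨G, hG, hmax⟩ := Set.exists_max_image
      {G : SimpleGraph V | ∑ a, deg G a = ∑ a, deg G₀ a} (fun G => ∑ a, deg G a ^ 2)
      (Set.toFinite _) ⟨G₀, rfl⟩
    have hle := hmax G₀ rfl
    simp only [Set.mem_ofPred_eq] at hG hmax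
    suffices h : ∃ A ⊆ Finset.Ioc 0 n, ∑ x, deg G x = 2 * ∑ a ∈ A, (a : ℚ) ∧
        ∑ x, deg G x ^ 2 ≤ weight A - ∑ a ∈ A, (a : ℚ) by
      obtain ⟨A, hA, h1, h2⟩ := h
      exact ⟨A, hA, hG ▸ h1, hle.trans h2⟩
    have : Nonempty V := Fintype.card_pos_iff.1 (by omega)
    obtain ⟨x, hx⟩ := exists_isolated_or_dominating (G := G) fun H hH => hmax H (hH.trans hG)
    let f : Option {y // y ≠ x} ≃ V := Equiv.optionSubtypeNe x
    have hcard : Fintype.card {y // y ≠ x} = n := by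
      have := Fintype.card_congr f
      rw [Fintype.card_option] at this
      omega
    obtain ⟨A, hA, h1, h2⟩ := ih _ hcard (G.comap fun w => f (some w))
    rcases hx with hx | hx
    · have h3 := HasDegrees.of_isolated f ⟨rfl, rfl⟩ fun w => hx _
      exact ⟨A, hA.trans (Finset.Ioc_subset_Ioc_right (Nat.sub_le _ _)),
        h3.sum_eq.trans h1, h3.sq_eq.le.trans h2⟩
    · have h3 := HasDegrees.of_dominating f ⟨rfl, rfl⟩ fun w => hx _ w.2
      rw [hcard] at h3
      rcases Nat.eq_zero_or_pos n with rfl | hn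
      · refine ⟨A, hA, ?_, ?_⟩
        · rw [h3.sum_eq, h1]; simp
        · rw [h3.sq_eq]
          have : A = ∅ := by simpa using hA
          subst this
          simp at h1 h2 ⊢
          linarith
      · have hs := (hasStats_self A).union (hasStats_singleton n) (by
          intro a ha b hb
          have := Finset.mem_Ioc.1 (hA ha)
          rw [Finset.mem_singleton.1 hb]
          omega)
        refine ⟨A ∪ {n}, ?_, ?_, ?_⟩
        · refine Finset.union_subset
            (hA.trans (Finset.Ioc_subset_Ioc_right (Nat.sub_le _ _))) ?_
          simp; omega
        · rw [h3.sum_eq, hs.sum_eq, h1]; ring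
        · rw [h3.sq_eq, hs.sum_eq, hs.weight_eq, h1]
          linarith

/-! ### Threshold graphs of strict partitions -/

theorem add_getD_lt {v : ℕ} {π : List ℕ} (hπ : π.Pairwise (· > ·)) (hv : ∀ a ∈ π, a < v) {s : ℕ}
    (hs : s < v) : s + π.getD s 0 < v := by
  induction π generalizing v s with
  | nil => simpa using hs
  | cons a l ih =>
    rw [List.pairwise_cons] at hπ
    have ha := hv a (by simp)
    cases s with
    | zero => simpa using ha
    | succ s =>
      have := ih (v := v - 1) hπ.2 (fun b hb => by have := hπ.1 b hb; omega) (s := s) (by omega)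
      rw [List.getD_cons_succ]
      omega

theorem Th_adj {v : ℕ} {π : List ℕ} {s t : Fin v} (h : s < t) :
    (Th v π).Adj s t ↔ t.val ≤ s.val + π.getD s.val 0 := by
  have h' : s.val < t.val := h
  simp only [Th, SimpleGraph.fromRel_adj]
  constructor
  · rintro ⟨-, h1 | h1⟩ <;> omega
  · exact fun h1 => ⟨h.ne, .inl ⟨h', h1⟩⟩

theorem eq_of_adj_iff {v : ℕ} {G H : SimpleGraph (Fin v)}
    (h : ∀ s t, s < t → (G.Adj s t ↔ H.Adj s t)) : G = H := by
  ext s t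
  rcases lt_trichotomy s t with h1 | rfl | h1
  · exact h s t h1
  · simp
  · rw [G.adj_comm, H.adj_comm]; exact h t s h1

/-- The number of edges and the sum of the squared degrees of a threshold graph. Either the last
vertex is isolated, or the first vertex is adjacent to all others and gives the largest part. -/
theorem Th_hasDegrees {v : ℕ} {π : List ℕ} (hπ : π.Pairwise (· > ·))
    (hv : ∀ a ∈ π, 0 < a ∧ a < v) :
    HasDegrees (Th v π) (2 * ∑ a ∈ π.toFinset, (a : ℚ))
      (weight π.toFinset - ∑ a ∈ π.toFinset, (a : ℚ)) := by
  induction v generalizing π with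
  | zero =>
    obtain rfl : π = [] := List.eq_nil_iff_forall_not_mem.2 fun a ha => by
      have := hv a ha; omega
    exact ⟨by simp, by simp [hasStats_empty.weight_eq]⟩
  | succ v ih =>
    by_cases hmem : v ∈ π
    · obtain ⟨l, rfl⟩ : ∃ l, π = v :: l := by
        cases π with
        | nil => simp at hmem
        | cons a l =>
          rw [List.pairwise_cons] at hπ
          rcases List.mem_cons.1 hmem with rfl | h
          · exact ⟨l, rfl⟩
          · have h1 := hπ.1 v h
            have h2 := hv a (by simp)
            omega
      rw [List.pairwise_cons] at hπ
      have h := ih hπ.2 fun a ha => ⟨(hv a (by simp [ha])).1, hπ.1 a ha⟩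
      have heq : Th v l = (Th (v + 1) (v :: l)).comap
          fun w => (finSuccEquiv v).symm (some w) := by
        refine eq_of_adj_iff fun s t hst => ?_
        have hst' : s.val < t.val := hst
        rw [Th_adj hst, SimpleGraph.comap_adj, finSuccEquiv_symm_some, finSuccEquiv_symm_some,
          Th_adj (Fin.succ_lt_succ_iff.2 hst)]
        simp only [Fin.val_succ, List.getD_cons_succ]
        omega
      rw [heq] at h
      have h' := h.of_dominating (finSuccEquiv v).symm fun w => by
        rw [finSuccEquiv_symm_some, finSuccEquiv_symm_none, Th_adj (Fin.succ_pos w)]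
        simp
      have hs := (hasStats_self l.toFinset).union (hasStats_singleton v) (by
        intro a ha b hb
        rw [Finset.mem_singleton.1 hb]
        exact hπ.1 a (List.mem_toFinset.1 ha))
      rw [List.toFinset_cons, Finset.insert_eq, Finset.union_comm, hs.sum_eq, hs.weight_eq]
      convert h' using 1 <;> simp <;> ring
    · have hv' : ∀ a ∈ π, 0 < a ∧ a < v := by
        intro a ha
        have h1 := hv a ha
        have h2 : a ≠ v := by rintro rfl; exact hmem ha
        omega
      have h := ih hπ hv'
      have heq : Th v π = (Th (v + 1) π).comap fun w => (finSuccEquivLast (n := v)).symm (some w) := by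
        refine eq_of_adj_iff fun s t hst => ?_
        rw [Th_adj hst, SimpleGraph.comap_adj, finSuccEquivLast_symm_some,
          finSuccEquivLast_symm_some, Th_adj (Fin.castSucc_lt_castSucc_iff.2 hst)]
        simp
      rw [heq] at h
      refine h.of_isolated (finSuccEquivLast (n := v)).symm fun w => ?_
      rw [finSuccEquivLast_symm_some, finSuccEquivLast_symm_none, SimpleGraph.adj_comm,
        Th_adj (Fin.castSucc_lt_last w)]
      have := add_getD_lt hπ (fun a ha => (hv' a ha).2) w.2
      simpa using this

/-! ### Strict partitions and their sets of parts -/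

theorem list_eq_of_toFinset_eq {l₁ l₂ : List ℕ} (h₁ : l₁.Pairwise (· > ·))
    (h₂ : l₂.Pairwise (· > ·)) (h : l₁.toFinset = l₂.toFinset) : l₁ = l₂ := by
  have key : ∀ l : List ℕ, l.Pairwise (· > ·) → l.toFinset.sort (· ≥ ·) = l := fun l hl =>
    (List.toFinset_sort (· ≥ ·) (hl.imp fun h => ne_of_gt h)).2 (hl.imp fun h => le_of_lt h)
  rw [← key l₁ h₁, ← key l₂ h₂, h]

theorem mem_Dis_iff {v e : ℕ} {π : List ℕ} : π ∈ Dis v e ↔ π.Pairwise (· > ·) ∧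
    π.toFinset ⊆ Finset.Ioc 0 (v - 1) ∧ ∑ a ∈ π.toFinset, (a : ℚ) = e := by
  have hsum : π.Pairwise (· > ·) → ∑ a ∈ π.toFinset, (a : ℚ) = (π.sum : ℕ) := by
    intro h
    rw [List.sum_toFinset _ (h.imp fun h => ne_of_gt h), Nat.cast_list_sum]
  have hsub : (∀ a ∈ π, 0 < a ∧ a < v) ↔ π.toFinset ⊆ Finset.Ioc 0 (v - 1) := by
    refine forall_congr' fun a => ?_
    rw [List.mem_toFinset, Finset.mem_Ioc]
    exact imp_congr_right fun _ => by omega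
  simp only [Dis, Set.mem_ofPred_eq]
  rw [hsub]
  refine and_congr_right fun h => and_congr_right fun _ => ?_
  rw [hsum h, Nat.cast_inj]

theorem exists_mem_Dis {v e : ℕ} {A : Finset ℕ} (hA : A ⊆ Finset.Ioc 0 (v - 1))
    (hs : ∑ a ∈ A, (a : ℚ) = e) : ∃ π ∈ Dis v e, π.toFinset = A := by
  refine ⟨A.sort (· ≥ ·), mem_Dis_iff.2 ⟨?_, by simpa, by simpa⟩, by simp⟩
  have h1 := A.pairwise_sort (· ≥ ·)
  have h2 : (A.sort (· ≥ ·)).Pairwise (· ≠ ·) := A.sort_nodup (· ≥ ·)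
  exact h1.imp₂ (fun _ _ h h' => lt_of_le_of_ne h h'.symm) h2

theorem mem_graphClass_iff {v e : ℕ} {G : SimpleGraph (Fin v)} :
    G ∈ graphClass v e ↔ ∑ x, deg G x = 2 * e := by
  rw [sum_deg]
  simp [graphClass]

theorem Dis.hasDegrees {v e : ℕ} {π : List ℕ} (h : π ∈ Dis v e) :
    HasDegrees (Th v π) (2 * e) (weight π.toFinset - e) := by
  have := Th_hasDegrees h.1 h.2.1
  rwa [(mem_Dis_iff.1 h).2.2] at this

theorem P2_Th {v e : ℕ} {π : List ℕ} (h : π ∈ Dis v e) :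
    (P2 (Th v π) : ℚ) = weight π.toFinset - e := by
  rw [P2_eq_sum_deg, (Dis.hasDegrees h).sq_eq]

/-- A strict partition is optimal if and only if its set of parts has maximum weight. -/
theorem isOptimal_iff {v e : ℕ} {π : List ℕ} (h : π ∈ Dis v e) :
    IsOptimal v e π ↔ IsMax (v - 1) π.toFinset := by
  have h' := mem_Dis_iff.1 h
  constructor
  · intro ho
    refine ⟨h'.2.1, fun B hB hs => ?_⟩
    obtain ⟨ρ, hρ, rfl⟩ := exists_mem_Dis hB (hs.trans h'.2.2)
    have := ho.2.2 (Th v ρ) (mem_graphClass_iff.2 (Dis.hasDegrees hρ).sum_eq)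
    have : (P2 (Th v ρ) : ℚ) ≤ P2 (Th v π) := by exact_mod_cast this
    rw [P2_Th h, P2_Th hρ] at this
    linarith
  · intro hm
    refine ⟨h, mem_graphClass_iff.2 (Dis.hasDegrees h).sum_eq, fun H hH => ?_⟩
    obtain ⟨A, hA, h1, h2⟩ := exists_weight_ge v (Fin v) (by simp) H
    rw [mem_graphClass_iff.1 hH] at h1
    have h3 := hm.2 A hA (by rw [h'.2.2]; linarith)
    have : (P2 H : ℚ) ≤ P2 (Th v π) := by
      rw [P2_eq_sum_deg, P2_Th h]
      linarith
    exact_mod_cast this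

theorem pairwise_desc (a b : ℕ) : (desc a b).Pairwise (· > ·) := by
  rw [desc, List.pairwise_reverse]
  exact List.pairwise_lt_range'

theorem mem_desc {a b x : ℕ} : x ∈ desc a b ↔ b ≤ x ∧ x ≤ a := by
  simp [desc, List.mem_range'_1]; omega

/-! ### The six partitions -/

theorem kOf_jOf_spec (e : ℕ) : 0 < jOf e ∧ jOf e ≤ kOf e ∧
    (e : ℚ) = kOf e * (kOf e + 1) / 2 - jOf e := by
  obtain ⟨h1, h2, h3⟩ := (eq_choose_sub_iff e _ _).2 ⟨rfl, rfl⟩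
  refine ⟨h2, h3, ?_⟩
  have : ((e + jOf e : ℕ) : ℚ) = ((kOf e + 1).choose 2 : ℕ) := by rw [h1]
  rw [Nat.cast_choose_two] at this
  push_cast at this
  linarith

/-- A graph with `v` vertices has `kOf e ≤ v`, with equality only for the complete graph. -/
theorem kOf_le {v e : ℕ} (hv : 0 < v) (he : e ≤ v.choose 2) : kOf e ≤ v ∧ (kOf e = v → jOf e = v) := by
  obtain ⟨h1, h2, h3⟩ := (eq_choose_sub_iff e _ _).2 ⟨rfl, rfl⟩
  have succ : ∀ n : ℕ, (n + 1).choose 2 = n + n.choose 2 := fun n => by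
    rw [Nat.choose_succ_succ' n 1, Nat.choose_one_right]
  have h4 := succ (kOf e)
  constructor
  · by_contra hcon
    have := Nat.choose_le_choose 2 (show v + 1 ≤ kOf e by omega)
    have := succ v
    omega
  · intro h
    rw [h] at h4 h1 h3
    omega

theorem add_coEdges {v e : ℕ} (he : e ≤ v.choose 2) :
    (e : ℚ) + coEdges v e = v * (v - 1) / 2 := by
  have : e + coEdges v e = v.choose 2 := by unfold coEdges; omega
  rw [← Nat.cast_choose_two, ← this]
  push_cast; rfl

theorem sum_compl {v e : ℕ} (hv : 0 < v) (he : e ≤ v.choose 2) {A : Finset ℕ}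
    (hA : A ⊆ Finset.Ioc 0 (v - 1)) : ∑ a ∈ A, (a : ℚ) = e ↔
      ∑ a ∈ Finset.Ioc 0 (v - 1) \ A, (a : ℚ) = coEdges v e := by
  have h1 : ∑ a ∈ Finset.Ioc 0 (v - 1) \ A, (a : ℚ) + ∑ a ∈ A, (a : ℚ) = _ := Finset.sum_sdiff hA
  rw [(hasStats_Ioc (Nat.zero_le (v - 1))).sum_eq, Nat.cast_sub hv] at h1
  have h2 := add_coEdges he
  push_cast at h1
  constructor <;> intro h <;> linarith

/-- The weight of `π₂.₁`, and of `π₂.₂` and `π₂.₃` when they exist. -/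
def qcWeight (e : ℕ) : ℚ :=
  (kOf e * (kOf e + 1) * (2 * kOf e + 1) / 2 - jOf e ^ 2 - 2 * jOf e
    - 4 * jOf e * (kOf e - jOf e) - 2 * jOf e * (jOf e - 1) : ℚ)

/-- The weight of `π₁.₁`, and of `π₁.₂` and `π₁.₃` when they exist. -/
def qsWeight (v e : ℕ) : ℚ :=
  qcWeight (coEdges v e) + (2 * v - 1) * (e - coEdges v e)

/-- `π` is a member of `Dis(v,e)` whose set of parts `A` has weight `w`. -/
structure IsPartition (v e : ℕ) (π : List ℕ) (A : Finset ℕ) (w : ℚ) : Prop where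
  mem : π ∈ Dis v e
  toFinset_eq : π.toFinset = A
  weight_eq : weight A = w

theorem IsPartition.of_hasStats {v e : ℕ} {π : List ℕ} {A : Finset ℕ} {c s w : ℚ}
    (h : HasStats A c s w) (hp : π.Pairwise (· > ·)) (hA : π.toFinset = A)
    (hsub : A ⊆ Finset.Ioc 0 (v - 1)) (hs : s = e) : IsPartition v e π A w :=
  ⟨mem_Dis_iff.2 ⟨hp, hA ▸ hsub, by rw [hA, h.sum_eq, hs]⟩, hA, h.weight_eq⟩

theorem IsPartition.of_compl {v e : ℕ} (hv : 0 < v) (he : e ≤ v.choose 2) {π : List ℕ}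
    {A : Finset ℕ} {c s w : ℚ} (h : HasStats A c s w) (hp : π.Pairwise (· > ·))
    (hA : π.toFinset = Finset.Ioc 0 (v - 1) \ A) (hsub : A ⊆ Finset.Ioc 0 (v - 1))
    (hs : s = coEdges v e) : IsPartition v e π (Finset.Ioc 0 (v - 1) \ A)
      (w + (2 * v - 1) * (e - coEdges v e)) := by
  have h1 : ∑ a ∈ Finset.Ioc 0 (v - 1) \ A, (a : ℚ) = e := by
    rw [sum_compl hv he Finset.sdiff_subset, Finset.sdiff_sdiff_eq_self hsub, h.sum_eq, hs]
  refine ⟨mem_Dis_iff.2 ⟨hp, hA ▸ Finset.sdiff_subset, by rw [hA, h1]⟩, hA, ?_⟩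
  have h2 := weight_compl hsub
  rw [h.weight_eq, h1, h.sum_eq, hs, Nat.cast_sub hv] at h2
  push_cast at h2
  linarith

theorem IsPartition.isOptimal_iff {v e : ℕ} {π : List ℕ} {A : Finset ℕ} {w : ℚ}
    (h : IsPartition v e π A w) : IsOptimal v e π ↔ IsMax (v - 1) A := by
  rw [SumSquares.isOptimal_iff h.mem, h.toFinset_eq]

theorem IsPartition.eq {v e : ℕ} {π ρ : List ℕ} {A : Finset ℕ} {w : ℚ}
    (h : IsPartition v e π A w) (hρ : ρ ∈ Dis v e) (hA : ρ.toFinset = A) : ρ = π :=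
  list_eq_of_toFinset_eq hρ.1 h.mem.1 (hA.trans h.toFinset_eq.symm)

theorem IsPartition.isOptimal_congr {v e : ℕ} {π ρ : List ℕ} {A B : Finset ℕ} {w : ℚ}
    (h : IsPartition v e π A w) (h' : IsPartition v e ρ B w) :
    IsOptimal v e π ↔ IsOptimal v e ρ := by
  have key : ∀ {π ρ : List ℕ} {A B : Finset ℕ}, IsPartition v e π A w → IsPartition v e ρ B w →
      IsOptimal v e π → IsOptimal v e ρ := by
    intro π ρ A B h h' ho
    refine ⟨h'.mem, mem_graphClass_iff.2 (Dis.hasDegrees h'.mem).sum_eq, fun H hH => ?_⟩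
    have h1 : (P2 (Th v π) : ℚ) = P2 (Th v ρ) := by
      rw [P2_Th h.mem, P2_Th h'.mem, h.toFinset_eq, h'.toFinset_eq, h.weight_eq, h'.weight_eq]
    rw [← Nat.cast_inj.1 h1]
    exact ho.2.2 H hH
  exact ⟨key h h', key h' h⟩

section Six

variable {v e : ℕ}

theorem set21_subset (hv : 0 < v) (he : e ≤ v.choose 2) :
    set21 (kOf e) (jOf e) ⊆ Finset.Ioc 0 (v - 1) := by
  have h := kOf_le hv he
  have h' := kOf_jOf_spec e
  intro x
  simp only [set21, Finset.mem_union, Finset.mem_Ioc]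
  omega

theorem set23_subset (he : e ≤ v.choose 2) (hj : jOf e = 3) (hv : 4 ≤ v) :
    set23 (kOf e) ⊆ Finset.Ioc 0 (v - 1) := by
  have h := kOf_le (by omega) he
  intro x
  simp only [set23, Finset.mem_Ioc]
  omega

theorem set22_subset (h : kOf e + 1 ≤ 2 * kOf e - jOf e - 1)
    (h' : 2 * kOf e - jOf e - 1 ≤ v - 1) :
    set22 (kOf e) (jOf e) ⊆ Finset.Ioc 0 (v - 1) := by
  intro x
  simp only [set22, Finset.mem_union, Finset.mem_Ioc, Finset.mem_singleton]
  omega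

theorem isPartition_pi21 (hv : 0 < v) (he : e ≤ v.choose 2) :
    IsPartition v e (pi21 e) (set21 (kOf e) (jOf e)) (qcWeight e) := by
  obtain ⟨h1, h2, h3⟩ := kOf_jOf_spec e
  refine .of_hasStats (hasStats_set21 h1 h2)
    ((pairwise_desc _ _).sublist List.erase_sublist) ?_ (set21_subset hv he) h3.symm
  ext x
  rw [List.mem_toFinset, pi21, List.Nodup.mem_erase_iff
    ((pairwise_desc _ _).imp fun h => ne_of_gt h), mem_desc]
  simp only [set21, Finset.mem_union, Finset.mem_Ioc]
  omega

theorem isPartition_pi22 (h : Exists22 v e) :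
    IsPartition v e (pi22 e) (set22 (kOf e) (jOf e)) (qcWeight e) := by
  obtain ⟨h1, h2, h3⟩ := kOf_jOf_spec e
  refine .of_hasStats (hasStats_set22 h1 h.1) ?_ ?_ (set22_subset h.1 h.2) h3.symm
  · refine List.pairwise_cons.2 ⟨fun x hx => ?_, pairwise_desc _ _⟩
    have := mem_desc.1 hx
    have := h.1
    omega
  · ext x
    rw [List.mem_toFinset, pi22, List.mem_cons, mem_desc]
    simp only [set22, Finset.mem_union, Finset.mem_Ioc, Finset.mem_singleton]
    omega

theorem isPartition_pi23 (he : e ≤ v.choose 2) (h : Exists23 v e) :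
    IsPartition v e (pi23 e) (set23 (kOf e)) (qcWeight e) := by
  obtain ⟨h1, h2, h3⟩ := kOf_jOf_spec e
  have hs := hasStats_set23 (h.1 ▸ h2)
  refine .of_hasStats (c := kOf e - 2) (s := kOf e * (kOf e + 1) / 2 - jOf e) ?_
    (pairwise_desc _ _) ?_ (set23_subset he h.1 h.2) h3.symm
  · rw [qcWeight, h.1]; exact_mod_cast hs
  · ext x
    rw [List.mem_toFinset, pi23, mem_desc, set23, Finset.mem_Ioc]
    omega

theorem coEdges_le (v e : ℕ) : coEdges v e ≤ v.choose 2 := Nat.sub_le _ _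

theorem isPartition_pi11 (hv : 0 < v) (he : e ≤ v.choose 2) :
    IsPartition v e (pi11 v e)
      (Finset.Ioc 0 (v - 1) \ set21 (kOf' v e) (jOf' v e)) (qsWeight v e) := by
  obtain ⟨h1, h2, h3⟩ := kOf_jOf_spec (coEdges v e)
  have h4 := kOf_le hv (coEdges_le v e)
  unfold pi11 kOf' jOf'
  refine .of_compl hv he (hasStats_set21 h1 h2) ?_ ?_ (set21_subset hv (coEdges_le v e)) h3.symm
  · split_ifs
    · exact List.Pairwise.nil
    · refine List.pairwise_append.2 ⟨pairwise_desc _ _, List.pairwise_singleton _ _, ?_⟩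
      intro a ha b hb
      rw [List.mem_singleton.1 hb]
      have := mem_desc.1 ha
      omega
  · ext x
    split_ifs with h
    · have := h4.2 h
      simp only [set21, Finset.mem_sdiff, Finset.mem_union, Finset.mem_Ioc, List.mem_toFinset,
        List.not_mem_nil, false_iff]
      omega
    · simp only [set21, Finset.mem_sdiff, Finset.mem_union, Finset.mem_Ioc, List.mem_toFinset,
        List.mem_append, mem_desc, List.mem_singleton]
      omega

theorem isPartition_pi12 (hv : 0 < v) (he : e ≤ v.choose 2) (h : Exists12 v e) :
    IsPartition v e (pi12 v e)
      (Finset.Ioc 0 (v - 1) \ set22 (kOf' v e) (jOf' v e)) (qsWeight v e) := by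
  obtain ⟨h1, h2, h3⟩ := kOf_jOf_spec (coEdges v e)
  refine .of_compl hv he (hasStats_set22 h1 h.1)
    ((pairwise_desc _ _).sublist List.erase_sublist) ?_ (set22_subset h.1 h.2) h3.symm
  ext x
  rw [List.mem_toFinset, pi12, List.Nodup.mem_erase_iff
    ((pairwise_desc _ _).imp fun h => ne_of_gt h), mem_desc]
  have := h.1
  simp only [set22, Finset.mem_sdiff, Finset.mem_union, Finset.mem_Ioc, Finset.mem_singleton]
  omega

theorem isPartition_pi13 (hv : 0 < v) (he : e ≤ v.choose 2) (h : Exists13 v e) :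
    IsPartition v e (pi13 v e)
      (Finset.Ioc 0 (v - 1) \ set23 (kOf' v e)) (qsWeight v e) := by
  obtain ⟨h1, h2, h3⟩ := kOf_jOf_spec (coEdges v e)
  have hj : jOf (coEdges v e) = 3 := h.1
  have hk : 3 ≤ kOf (coEdges v e) := hj ▸ h2
  have hk' := kOf_le hv (coEdges_le v e)
  have hv4 := h.2
  have hs := hasStats_set23 hk
  unfold pi13 kOf'
  refine .of_compl hv he (c := kOf (coEdges v e) - 2)
    (s := kOf (coEdges v e) * (kOf (coEdges v e) + 1) / 2 - jOf (coEdges v e))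
    (w := qcWeight (coEdges v e)) ?_ ?_ ?_ (set23_subset (coEdges_le v e) h.1 h.2) h3.symm
  · rw [qcWeight, hj]; exact_mod_cast hs
  · refine List.pairwise_append.2 ⟨pairwise_desc _ _, by simp, ?_⟩
    intro a ha b hb
    have := mem_desc.1 ha
    simp only [List.mem_cons, List.not_mem_nil, or_false] at hb
    omega
  · ext x
    simp only [set23, Finset.mem_sdiff, Finset.mem_Ioc, List.mem_toFinset,
      List.mem_append, mem_desc, List.mem_cons, List.not_mem_nil, or_false]
    omega

/-- Every optimal partition is one of the six. -/
theorem IsOptimal.eq_pi (hv : 0 < v) (he : e ≤ v.choose 2) {π : List ℕ} (h : IsOptimal v e π) :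
    (π = pi11 v e ∨ (Exists12 v e ∧ π = pi12 v e) ∨ (Exists13 v e ∧ π = pi13 v e)) ∨
    (π = pi21 e ∨ (Exists22 v e ∧ π = pi22 e) ∨ (Exists23 v e ∧ π = pi23 e)) := by
  have hm := (isOptimal_iff h.1).1 h
  have hs := (mem_Dis_iff.1 h.1).2.2
  rcases hm.quasiComplete with hq | hq
  · right
    rcases hq.eq_of_sum hm.1 hs with h1 | ⟨h1, h2, h3⟩ | ⟨h1, h2, h3⟩
    · exact .inl ((isPartition_pi21 hv he).eq h.1 h1)
    · exact .inr (.inl ⟨⟨h1, h2⟩, (isPartition_pi22 ⟨h1, h2⟩).eq h.1 h3⟩)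
    · exact .inr (.inr ⟨⟨h1, by omega⟩, (isPartition_pi23 he ⟨h1, by omega⟩).eq h.1 h3⟩)
  · left
    have hinj : ∀ {X}, Finset.Ioc 0 (v - 1) \ π.toFinset = X →
        π.toFinset = Finset.Ioc 0 (v - 1) \ X := by
      rintro X rfl
      rw [Finset.sdiff_sdiff_eq_self hm.1]
    rcases hq.eq_of_sum Finset.sdiff_subset ((sum_compl hv he hm.1).1 hs) with
      h1 | ⟨h1, h2, h3⟩ | ⟨h1, h2, h3⟩
    · exact .inl ((isPartition_pi11 hv he).eq h.1 (hinj h1))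
    · exact .inr (.inl ⟨⟨h1, h2⟩, (isPartition_pi12 hv he ⟨h1, h2⟩).eq h.1 (hinj h3)⟩)
    · exact .inr (.inr ⟨⟨h1, by omega⟩, (isPartition_pi13 hv he ⟨h1, by omega⟩).eq h.1 (hinj h3)⟩)

theorem IsMax.set21_of_set23 {n k : ℕ} (h : IsMax n (set23 k)) (hk : 3 ≤ k) (hn : k ≤ n) :
    IsMax n (set21 k 3) := by
  have s := hasStats_set21 (show 0 < 3 by omega) hk
  have s' := hasStats_set23 hk
  refine h.of_weight_eq ?_ (by rw [s.sum_eq, s'.sum_eq]; norm_num)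
    (by rw [s.weight_eq, s'.weight_eq]; norm_num)
  intro x
  simp only [set21, Finset.mem_union, Finset.mem_Ioc]
  omega

/-- Since `π₂.₃` has the weight of `π₂.₁`, the bound on `k` in `IsMax.small_of_set21_three` applies. -/
theorem quasiComplete_special (h2 : Exists22 v e) (h3 : Exists23 v e)
    (h : IsMax (v - 1) (set23 (kOf e))) : v = 7 ∧ e = 12 ∨ v = 9 ∧ e = 18 := by
  obtain ⟨h4, h5⟩ := h2
  obtain ⟨h6, h7⟩ := h3
  obtain ⟨h8, h9, h10⟩ := kOf_jOf_spec e
  rw [h6] at h4 h5 h9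
  rcases (h.set21_of_set23 h9 (by omega)).small_of_set21_three (by omega) (by omega) with h | h
  · rw [h.1, h6] at h10
    norm_num at h10
    have : e = 12 := by exact_mod_cast h10
    omega
  · rw [h.1, h6] at h10
    norm_num at h10
    have : e = 18 := by exact_mod_cast h10
    omega

theorem quasiStar_special (hv : 0 < v) (he : e ≤ v.choose 2) (h2 : Exists12 v e)
    (h3 : Exists13 v e) (h : IsOptimal v e (pi13 v e)) : v = 7 ∧ e = 9 ∨ v = 9 ∧ e = 18 := by
  have hm := ((isPartition_pi13 hv he h3).isOptimal_iff.1 h).compl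
  rw [kOf', Finset.sdiff_sdiff_eq_self (set23_subset (coEdges_le v e) h3.1 h3.2)] at hm
  rcases quasiComplete_special h2 h3 hm with ⟨rfl, h⟩ | ⟨rfl, h⟩ <;>
  · have : Nat.choose 7 2 = 21 := rfl
    have : Nat.choose 9 2 = 36 := rfl
    unfold coEdges at h
    omega

/-! ### Values of the quasi-complete and the quasi-star graph -/

theorem getD_desc (k s : ℕ) : (desc k 1).getD s 0 = k - s := by
  induction k generalizing s with
  | zero => simp [desc]
  | succ k ih =>
    have : desc (k + 1) 1 = (k + 1) :: desc k 1 := by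
      simp [desc, List.range'_1_concat, add_comm]
    rw [this]
    cases s with
    | zero => simp
    | succ s => rw [List.getD_cons_succ, ih]; omega

theorem getD_desc_erase {k j : ℕ} (hj : 0 < j) (hjk : j ≤ k) (s : ℕ) :
    ((desc k 1).erase j).getD s 0 = if s < k - j then k - s else k - 1 - s := by
  induction k generalizing s with
  | zero => omega
  | succ k ih =>
    have : desc (k + 1) 1 = (k + 1) :: desc k 1 := by
      simp [desc, List.range'_1_concat, add_comm]
    rw [this]
    rcases hjk.lt_or_eq with h | rfl
    · rw [List.erase_cons_tail (by simp; omega)]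
      cases s with
      | zero => simp; omega
      | succ s => rw [List.getD_cons_succ, ih (by omega)]; split_ifs <;> omega
    · rw [List.erase_cons_head, getD_desc]
      simp

theorem QC_eq_Th (v e : ℕ) : QC v e = Th v (pi21 e) := by
  obtain ⟨h1, h2, -⟩ := kOf_jOf_spec e
  refine eq_of_adj_iff fun s t hst => ?_
  have hst' : s.val < t.val := hst
  rw [Th_adj hst, pi21, getD_desc_erase h1 h2, QC, SimpleGraph.fromRel_adj]
  have := hst.ne
  split_ifs <;> constructor
  · omega
  · intro h; exact ⟨this, by omega⟩
  · omega
  · intro h; exact ⟨this, by omega⟩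

theorem C_eq_P2_Th (v e : ℕ) : C v e = P2 (Th v (pi21 e)) := by
  rw [C, QC_eq_Th]

theorem S_eq_P2_Th (hv : 0 < v) (he : e ≤ v.choose 2) : S v e = P2 (Th v (pi11 v e)) := by
  have h1 := isPartition_pi21 hv (coEdges_le v e)
  have h2 := isPartition_pi11 hv he
  have h3 := (Dis.hasDegrees h1.mem).compl.sq_eq
  have h4 := P2_Th h2.mem
  have h5 := add_coEdges he
  rw [h1.toFinset_eq, h1.weight_eq, ← QC_eq_Th, ← P2_eq_sum_deg, Fintype.card_fin] at h3
  rw [h2.toFinset_eq, h2.weight_eq, qsWeight] at h4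
  have : (S v e : ℚ) = P2 (Th v (pi11 v e)) := by
    rw [S, QS, h3, h4]
    have : (v : ℚ) * (v - 1) = 2 * (e + coEdges v e) := by linarith
    linear_combination (v - 1) * this
  exact_mod_cast this

theorem S_eq_C (hv : 0 < v) (he : e ≤ v.choose 2) (h1 : IsOptimal v e (pi11 v e))
    (h2 : IsOptimal v e (pi21 e)) : S v e = C v e := by
  rw [S_eq_P2_Th hv he, C_eq_P2_Th]
  exact le_antisymm (h2.2.2 _ h1.2.1) (h1.2.2 _ h2.2.1)

end Six

/-! ### Counting optimal partitions -/

section Count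

variable {v e : ℕ}

theorem isOptimal_pi22_iff (hv : 0 < v) (he : e ≤ v.choose 2) (h : Exists22 v e) :
    IsOptimal v e (pi22 e) ↔ IsOptimal v e (pi21 e) :=
  (isPartition_pi22 h).isOptimal_congr (isPartition_pi21 hv he)

theorem isOptimal_pi23_iff (hv : 0 < v) (he : e ≤ v.choose 2) (h : Exists23 v e) :
    IsOptimal v e (pi23 e) ↔ IsOptimal v e (pi21 e) :=
  (isPartition_pi23 he h).isOptimal_congr (isPartition_pi21 hv he)

theorem isOptimal_pi12_iff (hv : 0 < v) (he : e ≤ v.choose 2) (h : Exists12 v e) :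
    IsOptimal v e (pi12 v e) ↔ IsOptimal v e (pi11 v e) :=
  (isPartition_pi12 hv he h).isOptimal_congr (isPartition_pi11 hv he)

theorem isOptimal_pi13_iff (hv : 0 < v) (he : e ≤ v.choose 2) (h : Exists13 v e) :
    IsOptimal v e (pi13 v e) ↔ IsOptimal v e (pi11 v e) :=
  (isPartition_pi13 hv he h).isOptimal_congr (isPartition_pi11 hv he)

theorem encard_le_of_subset_finset {O : Set (List ℕ)} {F : Finset (List ℕ)} {n : ℕ}
    (h : O ⊆ F) (hF : F.card ≤ n) : O.encard ≤ n := by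
  refine (Set.encard_le_encard h).trans ?_
  rw [Set.encard_coe_eq_coe_finsetCard]
  exact_mod_cast hF

/-- If `a` and `b` are two conditional members of `O`, and not both occur, then those that occur
agree with a single list. -/
theorem exists_variant (P Q : Prop) (a b : List ℕ) (O : Set (List ℕ))
    (h : ¬ (P ∧ Q ∧ a ∈ O ∧ b ∈ O)) : ∃ y, ∀ π ∈ O, (P ∧ π = a) ∨ (Q ∧ π = b) → π = y := by
  by_cases h1 : P ∧ a ∈ O
  · refine ⟨a, ?_⟩
    rintro π hπ (⟨-, rfl⟩ | ⟨hQ, rfl⟩)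
    · rfl
    · exact absurd ⟨h1.1, hQ, h1.2, hπ⟩ h
  · refine ⟨b, ?_⟩
    rintro π hπ (⟨hP, rfl⟩ | ⟨-, rfl⟩)
    · exact absurd ⟨hP, hπ⟩ h1
    · rfl

/-- The quasi-star variants both exist and are optimal only in two special cases. -/
theorem special_of_variants_star (hv : 0 < v) (he : e ≤ v.choose 2)
    (h : Exists12 v e ∧ Exists13 v e ∧
      pi12 v e ∈ optimalPartitions v e ∧ pi13 v e ∈ optimalPartitions v e) :
    v = 7 ∧ e = 9 ∨ v = 9 ∧ e = 18 :=
  quasiStar_special hv he h.1 h.2.1 h.2.2.2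

/-- The quasi-complete variants both exist and are optimal only in two special cases. -/
theorem special_of_variants_complete (he : e ≤ v.choose 2)
    (h : Exists22 v e ∧ Exists23 v e ∧
      pi22 e ∈ optimalPartitions v e ∧ pi23 e ∈ optimalPartitions v e) :
    v = 7 ∧ e = 12 ∨ v = 9 ∧ e = 18 :=
  quasiComplete_special h.1 h.2.1 ((isPartition_pi23 he h.2.1).isOptimal_iff.1 h.2.2.2)

theorem encard_optimalPartitions_le_four (hv : 0 < v) (he : e ≤ v.choose 2)
    (h : ¬ (v = 7 ∧ e = 9 ∨ v = 7 ∧ e = 12 ∨ v = 9 ∧ e = 18)) :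
    (optimalPartitions v e).encard ≤ (4 : ℕ) := by
  obtain ⟨y, hy⟩ := exists_variant _ _ _ _ (optimalPartitions v e) fun h' =>
    h ((special_of_variants_star hv he h').imp_right .inr)
  obtain ⟨z, hz⟩ := exists_variant _ _ _ _ (optimalPartitions v e) fun h' =>
    h (.inr (special_of_variants_complete he h'))
  refine encard_le_of_subset_finset (F := {pi11 v e, pi21 e, y, z}) (fun π hπ => ?_)
    Finset.card_le_four
  simp only [Finset.coe_insert, Finset.coe_singleton, Set.mem_insert_iff, Set.mem_singleton_iff]
  rcases IsOptimal.eq_pi hv he hπ with (h1 | h1) | (h1 | h1)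
  · exact .inl h1
  · exact .inr (.inr (.inl (hy π hπ h1)))
  · exact .inr (.inl h1)
  · exact .inr (.inr (.inr (hz π hπ h1)))

/-- If the quasi-complete partition is not optimal, at most two partitions are, apart from the two
special cases of the quasi-star variants. -/
theorem encard_le_two_of_not_pi21 (hv : 0 < v) (he : e ≤ v.choose 2)
    (h : ¬ (v = 7 ∧ e = 9 ∨ v = 9 ∧ e = 18)) (h' : ¬ IsOptimal v e (pi21 e)) :
    (optimalPartitions v e).encard ≤ (2 : ℕ) := by
  obtain ⟨y, hy⟩ := exists_variant _ _ _ _ (optimalPartitions v e) fun h' =>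
    h (special_of_variants_star hv he h')
  refine encard_le_of_subset_finset (F := {pi11 v e, y}) (fun π hπ => ?_) Finset.card_le_two
  simp only [Finset.coe_insert, Finset.coe_singleton, Set.mem_insert_iff, Set.mem_singleton_iff]
  have hy' := hy π hπ
  rcases IsOptimal.eq_pi hv he hπ with h1 | rfl | ⟨hx, rfl⟩ | ⟨hx, rfl⟩
  · tauto
  · exact absurd hπ h'
  · exact absurd ((isOptimal_pi22_iff hv he hx).1 hπ) h'
  · exact absurd ((isOptimal_pi23_iff hv he hx).1 hπ) h'

/-- If the quasi-star partition is not optimal, at most two partitions are, apart from the two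
special cases of the quasi-complete variants. -/
theorem encard_le_two_of_not_pi11 (hv : 0 < v) (he : e ≤ v.choose 2)
    (h : ¬ (v = 7 ∧ e = 12 ∨ v = 9 ∧ e = 18)) (h' : ¬ IsOptimal v e (pi11 v e)) :
    (optimalPartitions v e).encard ≤ (2 : ℕ) := by
  obtain ⟨y, hy⟩ := exists_variant _ _ _ _ (optimalPartitions v e) fun h' =>
    h (special_of_variants_complete he h')
  refine encard_le_of_subset_finset (F := {pi21 e, y}) (fun π hπ => ?_) Finset.card_le_two
  simp only [Finset.coe_insert, Finset.coe_singleton, Set.mem_insert_iff, Set.mem_singleton_iff]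
  have hy' := hy π hπ
  rcases IsOptimal.eq_pi hv he hπ with (rfl | ⟨hx, rfl⟩ | ⟨hx, rfl⟩) | h1
  · exact absurd hπ h'
  · exact absurd ((isOptimal_pi12_iff hv he hx).1 hπ) h'
  · exact absurd ((isOptimal_pi13_iff hv he hx).1 hπ) h'
  · tauto

/-! ### The pairs `(7,9)`, `(7,12)` and `(9,18)` -/

theorem kOf_jOf_eq {e k j : ℕ} (h : e + j = (k + 1).choose 2 ∧ 1 ≤ j ∧ j ≤ k) :
    kOf e = k ∧ jOf e = j :=
  ((eq_choose_sub_iff e k j).1 h).imp Eq.symm Eq.symm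

theorem kOf_jOf_nine : kOf 9 = 4 ∧ jOf 9 = 1 := kOf_jOf_eq (by decide)

theorem kOf_jOf_twelve : kOf 12 = 5 ∧ jOf 12 = 3 := kOf_jOf_eq (by decide)

theorem kOf_jOf_eighteen : kOf 18 = 6 ∧ jOf 18 = 3 := kOf_jOf_eq (by decide)

theorem coEdges_seven_nine : coEdges 7 9 = 12 := rfl

theorem coEdges_seven_twelve : coEdges 7 12 = 9 := rfl

theorem coEdges_nine_eighteen : coEdges 9 18 = 18 := rfl

/-- In the special cases the quasi-star and the quasi-complete partition have the same weight. -/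
theorem isOptimal_pi11_iff_pi21 (h : v = 7 ∧ e = 9 ∨ v = 7 ∧ e = 12 ∨ v = 9 ∧ e = 18) :
    IsOptimal v e (pi11 v e) ↔ IsOptimal v e (pi21 e) := by
  have hv : 0 < v := by omega
  have he : e ≤ v.choose 2 := by
    rcases h with ⟨rfl, rfl⟩ | ⟨rfl, rfl⟩ | ⟨rfl, rfl⟩ <;> decide
  have h1 := isPartition_pi11 hv he
  have h2 := isPartition_pi21 hv he
  have h3 : qsWeight v e = qcWeight e := by
    rcases h with ⟨rfl, rfl⟩ | ⟨rfl, rfl⟩ | ⟨rfl, rfl⟩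
    · rw [qsWeight, qcWeight, qcWeight, coEdges_seven_nine, kOf_jOf_nine.1, kOf_jOf_nine.2,
        kOf_jOf_twelve.1, kOf_jOf_twelve.2]
      norm_num
    · rw [qsWeight, qcWeight, qcWeight, coEdges_seven_twelve, kOf_jOf_nine.1, kOf_jOf_nine.2,
        kOf_jOf_twelve.1, kOf_jOf_twelve.2]
      norm_num
    · rw [qsWeight, coEdges_nine_eighteen]
      norm_num
  rw [h3] at h1
  exact h1.isOptimal_congr h2

theorem encard_seven_nine : (optimalPartitions 7 9).encard ≤ (4 : ℕ) := by
  have h13 : pi13 7 9 = pi22 9 := by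
    rw [pi13, pi22, kOf', coEdges_seven_nine, kOf_jOf_nine.1, kOf_jOf_nine.2, kOf_jOf_twelve.1]
    decide
  have h23 : ¬ Exists23 7 9 := fun h => by
    have := h.1
    rw [kOf_jOf_nine.2] at this
    omega
  refine encard_le_of_subset_finset (F := {pi11 7 9, pi12 7 9, pi21 9, pi22 9}) (fun π hπ => ?_)
    Finset.card_le_four
  have := IsOptimal.eq_pi (by decide) (by decide) hπ
  rw [h13] at this
  simp only [Finset.coe_insert, Finset.coe_singleton, Set.mem_insert_iff, Set.mem_singleton_iff]
  tauto

theorem encard_seven_twelve : (optimalPartitions 7 12).encard ≤ (4 : ℕ) := by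
  have h12 : pi12 7 12 = pi23 12 := by
    rw [pi12, pi23, kOf', jOf', coEdges_seven_twelve, kOf_jOf_nine.1, kOf_jOf_nine.2,
      kOf_jOf_twelve.1]
    decide
  have h13 : ¬ Exists13 7 12 := fun h => by
    have := h.1
    rw [jOf', coEdges_seven_twelve, kOf_jOf_nine.2] at this
    omega
  refine encard_le_of_subset_finset (F := {pi11 7 12, pi21 12, pi22 12, pi23 12})
    (fun π hπ => ?_) Finset.card_le_four
  have := IsOptimal.eq_pi (by decide) (by decide) hπ
  rw [h12] at this
  simp only [Finset.coe_insert, Finset.coe_singleton, Set.mem_insert_iff, Set.mem_singleton_iff]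
  tauto

theorem exists_isOptimal (hv : 0 < v) (he : e ≤ v.choose 2) : ∃ π, IsOptimal v e π := by
  classical
  obtain ⟨A, hA, hmax⟩ := ((Finset.Ioc 0 (v - 1)).powerset.filter
    fun A : Finset ℕ => ∑ a ∈ A, (a : ℚ) = e).exists_max_image weight
      ⟨(pi21 e).toFinset, by
        have := mem_Dis_iff.1 (isPartition_pi21 hv he).mem
        exact Finset.mem_filter.2 ⟨Finset.mem_powerset.2 this.2.1, this.2.2⟩⟩
  rw [Finset.mem_filter, Finset.mem_powerset] at hA
  obtain ⟨π, hπ, rfl⟩ := exists_mem_Dis hA.1 hA.2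
  refine ⟨π, (isOptimal_iff hπ).2 ⟨hA.1, fun B hB hs => hmax B ?_⟩⟩
  exact Finset.mem_filter.2 ⟨Finset.mem_powerset.2 hB, hs.trans hA.2⟩

theorem isOptimal_pi11_or_pi21 (hv : 0 < v) (he : e ≤ v.choose 2) :
    IsOptimal v e (pi11 v e) ∨ IsOptimal v e (pi21 e) := by
  obtain ⟨π, hπ⟩ := exists_isOptimal hv he
  rcases IsOptimal.eq_pi hv he hπ with
    (rfl | ⟨hx, rfl⟩ | ⟨hx, rfl⟩) | rfl | ⟨hx, rfl⟩ | ⟨hx, rfl⟩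
  · exact .inl hπ
  · exact .inl ((isOptimal_pi12_iff hv he hx).1 hπ)
  · exact .inl ((isOptimal_pi13_iff hv he hx).1 hπ)
  · exact .inr hπ
  · exact .inr ((isOptimal_pi22_iff hv he hx).1 hπ)
  · exact .inr ((isOptimal_pi23_iff hv he hx).1 hπ)

theorem encard_nine_eighteen : (optimalPartitions 9 18).encard = 6 := by
  have hv : 0 < 9 := by decide
  have he : 18 ≤ Nat.choose 9 2 := by decide
  have e22 : Exists22 9 18 := by
    rw [Exists22, kOf_jOf_eighteen.1, kOf_jOf_eighteen.2]; decide
  have e23 : Exists23 9 18 := by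
    rw [Exists23, kOf_jOf_eighteen.2]; decide
  have e12 : Exists12 9 18 := e22
  have e13 : Exists13 9 18 := e23
  have hiff := isOptimal_pi11_iff_pi21 (v := 9) (e := 18) (by decide)
  have h21 : IsOptimal 9 18 (pi21 18) := (isOptimal_pi11_or_pi21 hv he).elim hiff.1 id
  have h11 := hiff.2 h21
  have heq : optimalPartitions 9 18 = (({pi11 9 18, pi12 9 18, pi13 9 18, pi21 18, pi22 18,
      pi23 18} : Finset (List ℕ)) : Set (List ℕ)) := by
    ext π
    simp only [Finset.coe_insert, Finset.coe_singleton, Set.mem_insert_iff, Set.mem_singleton_iff]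
    constructor
    · intro hπ
      have := IsOptimal.eq_pi hv he hπ
      tauto
    · rintro (rfl | rfl | rfl | rfl | rfl | rfl)
      · exact h11
      · exact (isOptimal_pi12_iff hv he e12).2 h11
      · exact (isOptimal_pi13_iff hv he e13).2 h11
      · exact h21
      · exact (isOptimal_pi22_iff hv he e22).2 h21
      · exact (isOptimal_pi23_iff hv he e23).2 h21
  rw [heq, Set.encard_coe_eq_coe_finsetCard, pi11, pi12, pi13, pi21, pi22, pi23, kOf', jOf',
    coEdges_nine_eighteen, kOf_jOf_eighteen.1, kOf_jOf_eighteen.2]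
  decide

end Count

end SumSquares

open SumSquares in
theorem theorem2p3 (v e : ℕ) (hv : 0 < v) (he : e ≤ v.choose 2) :
    (Exists12 v e → Exists13 v e →
        IsOptimal v e (pi12 v e) → IsOptimal v e (pi13 v e) →
        (v = 7 ∧ e = 9) ∨ (v = 9 ∧ e = 18)) ∧
    (Exists22 v e → Exists23 v e →
        IsOptimal v e (pi22 e) → IsOptimal v e (pi23 e) →
        (v = 7 ∧ e = 12) ∨ (v = 9 ∧ e = 18)) ∧
    ((optimalPartitions v e).encard = 6 ↔ v = 9 ∧ e = 18) ∧
    (optimalPartitions v e).encard ≠ 5 ∧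
    (2 < (optimalPartitions v e).encard →
        S v e = C v e ∧ IsOptimal v e (pi21 e) ∧ IsOptimal v e (pi11 v e)) := by
  have hfour : (optimalPartitions v e).encard ≤ (4 : ℕ) ∨ v = 9 ∧ e = 18 := by
    by_cases h : v = 7 ∧ e = 9 ∨ v = 7 ∧ e = 12 ∨ v = 9 ∧ e = 18
    · rcases h with ⟨rfl, rfl⟩ | ⟨rfl, rfl⟩ | h
      · exact .inl encard_seven_nine
      · exact .inl encard_seven_twelve
      · exact .inr h
    · exact .inl (encard_optimalPartitions_le_four hv he h)
  refine ⟨fun h1 h2 h3 h4 => special_of_variants_star hv he ⟨h1, h2, h3, h4⟩,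
    fun h1 h2 h3 h4 => special_of_variants_complete he ⟨h1, h2, h3, h4⟩, ⟨fun h => ?_, ?_⟩,
    fun h => ?_, fun h => ?_⟩
  · refine hfour.resolve_left fun h' => ?_
    rw [h] at h'
    exact absurd h' (by decide)
  · rintro ⟨rfl, rfl⟩
    exact encard_nine_eighteen
  · rcases hfour with h' | ⟨rfl, rfl⟩
    · rw [h] at h'
      exact absurd h' (by decide)
    · rw [encard_nine_eighteen] at h
      exact absurd h (by decide)
  · have both : IsOptimal v e (pi21 e) ∧ IsOptimal v e (pi11 v e) := by
      by_cases hs : v = 7 ∧ e = 9 ∨ v = 7 ∧ e = 12 ∨ v = 9 ∧ e = 18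
      · have hiff := isOptimal_pi11_iff_pi21 hs
        have h21 := (isOptimal_pi11_or_pi21 hv he).elim hiff.1 id
        exact ⟨h21, hiff.2 h21⟩
      · constructor
        · by_contra hcon
          exact absurd h (not_lt.2 (encard_le_two_of_not_pi21 hv he (by tauto) hcon))
        · by_contra hcon
          exact absurd h (not_lt.2 (encard_le_two_of_not_pi11 hv he (by tauto) hcon))
    exact ⟨S_eq_C hv he both.2 both.1, both⟩
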